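/- \textbf{Conventions.} Let $d\ge 1$. A $d$-dimensional infinite word over a finite alphabet $\Gamma$ is a map $x:\mathbb{N}^d\to\Gamma$. An \emph{abstract numeration system} is a triple $S=(L,\Sigma,<)$, where $L$ is an infinite regular language over a totally ordered finite alphabet $(\Sigma,<)$; $\mathrm{rep}_S(n)$ denotes the $(n+1)$st word of $L$ in the genealogical order (first by length, then lexicographically). For words $w_1,\dots,w_d\in\Sigma^*$ put $m=\max_i|w_i|$ and let $(w_1,\dots,w_d)^{\#}=(\#^{m-|w_1|}w_1,\dots,\#^{m-|w_d|}w_d)$, read as a word of length $m$ over $(\Sigma\cup\{\#\})^d$, where $\#\notin\Sigma$. The word $x$ is \emph{$S$-automatic} if there is a deterministic finite automaton with output, with input alphabet $(\Sigma\cup\{\#\})^d$, whose output on $(\mathrm{rep}_S(n_1),\dots,\mathrm{rep}_S(n_d))^{\#}$ is $x(n_1,\dots,n_d)$ for all $n_1,\dots,n_d\ge 0$. A \emph{bounded $d$-dimensional picture} over a finite alphabet $B$ is a map $P$ from a box $\prod_{i=1}^d\{0,\dots,s_i-1\}$ to $B$, where either all $s_i$ are positive or all $s_i$ are $0$ (the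 empty picture); its shape is $|P|=(s_1,\dots,s_d)$. Let $\mu$ map every letter of $B$ to a bounded picture over $B$. For a bounded picture $P$, the picture $\mu(P)$ is well defined if, for all $i$ and $k$, all letters $b$ occurring in $P$ at a position whose $i$th coordinate is $k$ have the same $|\mu(b)|_i$; then $\mu(P)$ is the picture obtained by replacing every letter of $P$ by its image and concatenating these images in all $d$ directions. The map $\mu$ is a \emph{$d$-dimensional morphism} if, for every letter $b$, all iterates $\mu^n(b)$, $n\ge 0$, are successively well defined. It is \emph{prolongable} on $a\in B$ if $\mu(a)$ is nonempty and has the letter $a$ at position $(0,\dots,0)$. An infinite word $y:\mathbb{N}^d\to B$ is then the fixed point $y=\mu^\omega(a)$ if every $\mu^n(a)$ is the restriction of $y$ to a box at the origin and these boxes cover $\mathbb{N}^d$. The word $y$ is \emph{shape-symmetric} if $y=\mu^\omega(a)$ for some $d$-dimensional morphism $\mu$ prolongable on a letter $a$ such that, for every permutation $f$ of $\{1,\dots,d\}$ and all $n_1,\dots,n_d\ge 0$, if $|\mu(y(n_1,\dots,n_d))|=(s_1,\dots,s_d)$, then $|\mu(y(n_{f(1)},\dots,n_{f(d)}))|=(s_{f(1)},\dots,s_{f(d)})$.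 A \emph{coding} is a map between alphabets, applied letter by letter. \textbf{Theorem.} Let $d\ge 1$ and let $x$ be a $d$-dimensional infinite word over a finite alphabet. Then $x$ is $S$-automatic for some abstract numeration system $S=(L,\Sigma,<)$ with $\varepsilon\in L$ if and only if $x$ is the image under a coding of a shape-symmetric $d$-dimensional infinite word over a finite alphabet. -/

import Mathlib

namespace MultiWord

/-! ### Abstract numeration systems -/

/-- An abstract numeration system over the totally ordered alphabet `A`: an infinite regular
language over `A`. The alphabet is required to be finite where the system is used. -/
structure NumerationSystem (A : Type) where
  lang : Language A
  isRegular : lang.IsRegular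
  infinite : (lang : Set (List A)).Infinite

namespace NumerationSystem

variable {A : Type} [LinearOrder A]

/-- The genealogical order: first by length, then lexicographically. -/
def Genealogical (u v : List A) : Prop := List.Shortlex (· < ·) u v

theorem Genealogical.trans {u v w : List A} (h₁ : Genealogical u v) (h₂ : Genealogical v w) :
    Genealogical u w := by
  simp only [Genealogical, List.shortlex_def] at h₁ h₂ ⊢
  have tr : List.Lex (· < ·) u v → List.Lex (· < ·) v w → List.Lex (· < ·) u w :=
    fun a b => List.lt_trans (α := A) a b
  grind

/-- The number of words of the language that precede `w` in the genealogical order. -/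
noncomputable def val (S : NumerationSystem A) (w : {w : List A // w ∈ S.lang}) : ℕ :=
  Set.ncard {v : {w : List A // w ∈ S.lang} | Genealogical v.1 w.1}

theorem finite_preceding [Finite A] (S : NumerationSystem A) (w : {w : List A // w ∈ S.lang}) :
    {v : {w : List A // w ∈ S.lang} | Genealogical v.1 w.1}.Finite := by
  refine Set.Finite.subset
    ((List.finite_length_le A w.1.length).preimage Subtype.val_injective.injOn) ?_
  intro v hv
  simp only [Set.mem_ofPred_eq, Genealogical, List.shortlex_def] at hv
  simp only [Set.mem_preimage, Set.mem_ofPred_eq]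
  omega

theorem val_lt_val [Finite A] (S : NumerationSystem A) {v w : {w : List A // w ∈ S.lang}}
    (h : Genealogical v.1 w.1) : S.val v < S.val w := by
  refine Set.ncard_lt_ncard ⟨fun u hu => Genealogical.trans hu h, fun hs => ?_⟩
    (S.finite_preceding w)
  have h₁ : Genealogical v.1 v.1 := hs h
  exact Std.Asymm.asymm (r := List.Shortlex (α := A) (· < ·)) _ _ h₁ h₁

theorem val_injective [Finite A] (S : NumerationSystem A) : Function.Injective S.val := by
  intro v w h
  by_contra hne
  have ht : Genealogical v.1 w.1 ∨ Genealogical w.1 v.1 := by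
    by_contra hc
    push Not at hc
    exact hne (Subtype.ext
      (Std.Trichotomous.trichotomous (r := List.Shortlex (α := A) (· < ·)) _ _ hc.1 hc.2))
  rcases ht with ht | ht
  · exact (S.val_lt_val ht).ne h
  · exact (S.val_lt_val ht).ne h.symm

theorem val_bijective [Finite A] (S : NumerationSystem A) : Function.Bijective S.val := by
  refine ⟨S.val_injective, fun n => ?_⟩
  have : Infinite {w : List A // w ∈ S.lang} := S.infinite.to_subtype
  obtain ⟨m, ⟨w, rfl⟩, hw⟩ := (Set.infinite_range_of_injective S.val_injective).exists_gt n
  have himg : S.val '' {v | Genealogical v.1 w.1} = Set.Iio (S.val w) := by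
    refine Set.eq_of_subset_of_ncard_le ?_ ?_ (Set.finite_Iio _)
    · rintro _ ⟨v, hv, rfl⟩
      exact S.val_lt_val hv
    · rw [Set.ncard_image_of_injective _ S.val_injective]
      simp [val, Set.ncard_eq_toFinset_card']
  have hn : n ∈ S.val '' {v | Genealogical v.1 w.1} := by
    rw [himg]
    exact hw
  obtain ⟨v, -, hv⟩ := hn
  exact ⟨v, hv⟩

/-- `S.rep n` is the `(n+1)`st word of the language in the genealogical order; it is the
reciprocal of `val`. -/
noncomputable def rep [Finite A] (S : NumerationSystem A) (n : ℕ) : List A :=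
  ((Equiv.ofBijective S.val S.val_bijective).symm n).1

end NumerationSystem

/-! ### Automatic multidimensional words -/

/-- A deterministic automaton with output, with states `Q`, input alphabet `B` and output
alphabet `Γ`. The state set is required to be finite where the automaton is used. -/
structure DFAO (Q B : Type) (Γ : Type*) where
  step : Q → B → Q
  start : Q
  out : Q → Γ

/-- The output of the automaton on the input word `w`, read from left to right. -/
def DFAO.output {Q B : Type} {Γ : Type*} (M : DFAO Q B Γ) (w : List B) : Γ :=
  M.out (w.foldl M.step M.start)

/-- `(w₁, …, w_d)^#`: the words are padded on the left to their maximal length with the extra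
letter `# = none` and read in parallel. -/
def padTuple {d : ℕ} {A : Type} (w : Fin d → List A) : List (Fin d → Option A) :=
  let m := Finset.univ.sup fun i => (w i).length
  List.ofFn fun t : Fin m => fun i =>
    (List.replicate (m - (w i).length) none ++ (w i).map some).getD t none

/-- The `d`-dimensional infinite word `x` is automatic with respect to `S`. -/
def IsAutomaticFor {d : ℕ} {Γ : Type*} {A : Type} [LinearOrder A] [Finite A]
    (S : NumerationSystem A) (x : (Fin d → ℕ) → Γ) : Prop :=
  ∃ (Q : Type) (_ : Finite Q) (M : DFAO Q (Fin d → Option A) Γ),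
    ∀ n : Fin d → ℕ, M.output (padTuple fun i => S.rep (n i)) = x n

/-! ### Bounded pictures and multidimensional morphisms -/

/-- A bounded `d`-dimensional picture over `A`: either all side lengths are positive, or it is
the empty picture, of shape `(0, …, 0)`. -/
structure Picture (d : ℕ) (A : Type) where
  shape : Fin d → ℕ
  shape_pos_or_zero : (∀ i, 0 < shape i) ∨ ∀ i, shape i = 0
  entry : (∀ i, Fin (shape i)) → A

variable {d : ℕ} {A : Type}

/-- The letter `a` as a picture of shape `(1, …, 1)`. -/
def Picture.letter (d : ℕ) (a : A) : Picture d A where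
  shape := fun _ => 1
  shape_pos_or_zero := Or.inl fun _ => one_pos
  entry := fun _ => a

/-- `P` is the picture of its shape at the origin of the infinite word `x`. -/
def Picture.IsPrefix (P : Picture d A) (x : (Fin d → ℕ) → A) : Prop :=
  ∀ n : ∀ i, Fin (P.shape i), P.entry n = x fun i => n i

/-- `μ (P)` is well defined and equal to `R`. The first clause says that, for every direction `i`
and every `k`, the images of the letters of `P` in the hyperplane of index `k` in direction `i`
have a common side length `w i k` in direction `i`. The other two clauses say that `R` is the
concatenation, in all directions, of these images, each placed according to the position of its
letter in `P`. -/
def IsImage (μ : A → Picture d A) (P R : Picture d A) : Prop :=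
  ∃ w : Fin d → ℕ → ℕ,
    (∀ (p : ∀ i, Fin (P.shape i)) (i : Fin d), (μ (P.entry p)).shape i = w i (p i)) ∧
    (∀ i, R.shape i = ∑ k ∈ Finset.range (P.shape i), w i k) ∧
    ∀ (p : ∀ i, Fin (P.shape i)) (j : ∀ i, Fin ((μ (P.entry p)).shape i))
      (n : ∀ i, Fin (R.shape i)),
      (∀ i, (n i : ℕ) = ∑ k ∈ Finset.range (p i), w i k + j i) →
        R.entry n = (μ (P.entry p)).entry j

/-- `IsIterate μ a n P`: the picture `μ^n (a)` is well defined, step by step, and equals `P`. -/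
inductive IsIterate (μ : A → Picture d A) (a : A) : ℕ → Picture d A → Prop
  | zero : IsIterate μ a 0 (Picture.letter d a)
  | succ {n : ℕ} {P R : Picture d A} :
      IsIterate μ a n P → IsImage μ P R → IsIterate μ a (n + 1) R

/-- `μ` is a `d`-dimensional morphism: all iterates on all letters are well defined. -/
def IsMorphism (μ : A → Picture d A) : Prop :=
  ∀ (a : A) (n : ℕ), ∃ P : Picture d A, IsIterate μ a n P

/-- `μ` is prolongable on `a`: the letter at the origin of `μ (a)` is `a`. -/
def IsProlongable (μ : A → Picture d A) (a : A) : Prop :=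
  ∃ h : ∀ i, 0 < (μ a).shape i, (μ a).entry (fun i => ⟨0, h i⟩) = a

/-- The infinite word `x` is the limit `μ^ω (a)` of the pictures `μ^n (a)`: each of these is a
prefix of `x`, and every position of `ℕ^d` is covered by one of them. -/
def IsLimit (μ : A → Picture d A) (a : A) (x : (Fin d → ℕ) → A) : Prop :=
  (∀ (n : ℕ) (P : Picture d A), IsIterate μ a n P → P.IsPrefix x) ∧
  ∀ m : Fin d → ℕ, ∃ (n : ℕ) (P : Picture d A), IsIterate μ a n P ∧ ∀ i, m i < P.shape i

/-- The infinite word `x` is shape-symmetric: it is the fixed point `μ^ω (a)` of a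
`d`-dimensional morphism `μ` prolongable on a letter `a`, and permuting the coordinates of a
position permutes accordingly the shape of the image of the letter of `x` there. -/
def IsShapeSymmetric (x : (Fin d → ℕ) → A) : Prop :=
  ∃ (μ : A → Picture d A) (a : A),
    IsMorphism μ ∧ IsProlongable μ a ∧ IsLimit μ a x ∧
    ∀ (f : Equiv.Perm (Fin d)) (n : Fin d → ℕ),
      (μ (x fun i => n (f i))).shape = fun i => (μ (x n)).shape (f i)

end MultiWord

/-!
Both directions rest on the tree that a width function `w : ℕ → ℕ` puts on `ℕ`: the children of `n`
are the numbers `cum w n + j` with `j < w n`, where `cum w n = w 0 + ⋯ + w (n - 1)`. If `y` is the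
fixed point of a morphism `μ`, the letters of the image of `y n` are found at the positions all of
whose coordinates are children of the respective coordinates of `n`. Shape-symmetry says that one
and the same tree serves in all directions (`HasWidth`, `exists_hasWidth`,
`isShapeSymmetric_of_hasWidth`).

*From shape-symmetric to automatic.* The number `n` is represented by its address, the sequence of
ranks `j` along the branch from `0` to `n`, with leading zeros removed. Addresses of the same length
are ordered lexicographically like their nodes, so these words in genealogical order represent
`0, 1, 2, …` (`node_lt_node_of_shortlex`, `val_eq_of_strictMono`). They form a regular language,
since the width of `n` is read off the diagonal letter `y (n, …, n)`, and an automaton that descends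
from `y n` into `μ (y n)` computes `y` from the addresses of the coordinates, with padding read as
`0`. Words that end in a node without children do no harm, and this is why erasing morphisms in
dimension one need no separate treatment.

*From automatic to shape-symmetric.* Let `D` accept the padded words `#^r w` with `w` in the
language. The accepted words of length `m` in lexicographic order are the padded representations of
the first natural numbers (`words_paddedDFA_getElem`). The language need not be closed under
prefixes, so the prefix tree of words cannot be used directly. By Dickson's lemma there are lengths
`i < i + p` such that, from every state of `D`, the number of accepted words does not decrease from
`i` to `i + p` and is zero for both lengths or for neither, while it increases strictly from the
initial state (`exists_comparable_lengths`). A number is now encoded by an item `(u, t)`: its padded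
representation is `u v` with `v` of length `i`, and `t` is the rank of `v` among the words accepted
after `u`. Lengthening `u` by `p` letters, the items extending `u` are distributed over the items
`(u, t)`, each receiving at least one and the first receiving the surplus
(`exists_items_add_eq_flatMap`). This defines a tree without leaves in which each child extends the
`u` of its parent. Hence the state of `D` and the state of the given automaton after `u` evolve by
finite rules, and together with `t` they are the letters of the required morphism
(`isMorphism_productMap`, `exists_isShapeSymmetric`).
-/

namespace MultiWord

open NumerationSystem

/-! ### Widths and their partial sums -/

/-- The total width of the first `n` hyperplanes, when the hyperplane of index `k` has width
`w k`. -/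
def cum (w : ℕ → ℕ) (n : ℕ) : ℕ := ∑ k ∈ Finset.range n, w k

@[simp] theorem cum_zero (w : ℕ → ℕ) : cum w 0 = 0 := by simp [cum]

theorem cum_succ (w : ℕ → ℕ) (n : ℕ) : cum w (n + 1) = cum w n + w n := by
  simp [cum, Finset.sum_range_succ]

theorem cum_mono (w : ℕ → ℕ) : Monotone (cum w) :=
  monotone_nat_of_le_succ fun n => by rw [cum_succ]; omega

theorem cum_congr {w v : ℕ → ℕ} {n : ℕ} (h : ∀ k < n, w k = v k) : cum w n = cum v n :=
  Finset.sum_congr rfl fun k hk => h k (Finset.mem_range.1 hk)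

theorem cum_add_lt_cum {w : ℕ → ℕ} {p q j : ℕ} (hpq : p < q) (hj : j < w p) :
    cum w p + j < cum w q := by
  have h := cum_mono w (Nat.succ_le_of_lt hpq)
  rw [Nat.succ_eq_add_one, cum_succ] at h
  omega

theorem exists_eq_cum_add {w : ℕ → ℕ} {m N : ℕ} (h : m < cum w N) :
    ∃ p < N, ∃ j < w p, m = cum w p + j := by
  induction N with
  | zero => simp at h
  | succ N ih =>
    by_cases hm : m < cum w N
    · obtain ⟨p, hp, j, hj, e⟩ := ih hm
      exact ⟨p, by omega, j, hj, e⟩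
    · rw [cum_succ] at h
      exact ⟨N, by omega, m - cum w N, by omega, by omega⟩

theorem cum_add_inj {w : ℕ → ℕ} {p q j k : ℕ} (hj : j < w p) (hk : k < w q)
    (h : cum w p + j = cum w q + k) : p = q ∧ j = k := by
  rcases lt_trichotomy p q with hpq | rfl | hpq
  · have := cum_add_lt_cum hpq hj
    omega
  · exact ⟨rfl, by omega⟩
  · have := cum_add_lt_cum hpq hk
    omega

/-- If all widths are positive and the first one is at least `2`, then the prefixes generated from
the origin grow without bound. -/
theorem lt_iterate_cum {w : ℕ → ℕ} (h1 : ∀ n, 1 ≤ w n) (h0 : 2 ≤ w 0) (k : ℕ) :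
    k < (cum w)^[k] 1 := by
  have hle : ∀ n, 1 ≤ n → n + 1 ≤ cum w n := by
    intro n hn
    induction n, hn using Nat.le_induction with
    | base => rw [cum_succ]; simpa using h0
    | succ n hn ih => have := h1 n; rw [cum_succ]; omega
  induction k with
  | zero => simp
  | succ k ih =>
    rw [Function.iterate_succ_apply']
    have := hle _ (show 1 ≤ (cum w)^[k] 1 by omega)
    omega

/-! ### Fixed points of multidimensional morphisms -/

variable {d : ℕ} {B : Type}

/-- `HasWidth μ y w`: in the infinite word `y`, the image under `μ` of a letter at position `n`
has side `w (n i)` in every direction `i`, and `y` is the concatenation of these images. -/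
structure HasWidth (μ : B → Picture d B) (y : (Fin d → ℕ) → B) (w : ℕ → ℕ) : Prop where
  shape_eq : ∀ n i, (μ (y n)).shape i = w (n i)
  entry_eq : ∀ (n : Fin d → ℕ) (j : ∀ i, Fin ((μ (y n)).shape i)),
    y (fun i => cum w (n i) + j i) = (μ (y n)).entry j

/-- When all iterates on `a` are prefixes of `y`, their shapes are determined by the widths. -/
theorem IsIterate.shape_eq {μ : B → Picture d B} {y : (Fin d → ℕ) → B} {w : ℕ → ℕ} {a : B}
    (hpre : ∀ k P, IsIterate μ a k P → P.IsPrefix y)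
    (hw : ∀ n i, (μ (y n)).shape i = w (n i)) {k : ℕ} {P : Picture d B}
    (h : IsIterate μ a k P) : ∀ i, P.shape i = (cum w)^[k] 1 := by
  induction h with
  | zero => intro i; rfl
  | @succ k P R hP hR ih =>
    intro i
    obtain ⟨v, hv, hs, -⟩ := hR
    rw [hs, Function.iterate_succ_apply', ← ih i]
    refine cum_congr fun t ht => ?_
    -- a picture with a nonempty side has a position with any given coordinate in that direction
    have hpos : ∀ j, 0 < P.shape j := by
      rcases P.shape_pos_or_zero with h | h
      · exact h
      · have := h i; omega
    have := hv (Function.update (fun j => ⟨0, hpos j⟩) i ⟨t, ht⟩) i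
    rw [hpre k P hP, hw] at this
    simpa using this.symm

/-- The shape of the `k`th iterate is unique; this is seen before a width function is available. -/
theorem IsIterate.shape_unique {μ : B → Picture d B} {y : (Fin d → ℕ) → B} {a : B}
    (hpre : ∀ k P, IsIterate μ a k P → P.IsPrefix y) {k : ℕ} {P P' : Picture d B}
    (h : IsIterate μ a k P) (h' : IsIterate μ a k P') : P.shape = P'.shape := by
  induction k generalizing P P' with
  | zero => cases h; cases h'; rfl
  | succ k ih =>
    obtain _ | ⟨hP, v, hv, hs, -⟩ := h
    obtain _ | ⟨hP', v', hv', hs', -⟩ := h'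
    rename_i P P'
    have hPP := ih hP hP'
    funext i
    rw [hs, hs', ← hPP]
    refine cum_congr fun t ht => ?_
    have hpos : ∀ j, 0 < P.shape j := by
      rcases P.shape_pos_or_zero with h | h
      · exact h
      · have := h i; omega
    have e := hv (Function.update (fun j => ⟨0, hpos j⟩) i ⟨t, ht⟩) i
    have e' := hv' (Function.update (fun j => ⟨0, hPP ▸ hpos j⟩) i ⟨t, hPP ▸ ht⟩) i
    rw [hpre k P hP] at e
    rw [hpre k P' hP'] at e'
    simp only [Function.update_self] at e e'
    rw [← e, ← e']
    congr 3
    funext j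
    by_cases hj : j = i
    · subst hj; simp
    · simp [hj]

/-- A shape-symmetric fixed point has a width function that is common to all directions; it
generates arbitrarily long prefixes from the origin. -/
theorem exists_hasWidth {μ : B → Picture d B} {y : (Fin d → ℕ) → B} {a : B} (hd : 1 ≤ d)
    (hM : IsMorphism μ) (hlim : IsLimit μ a y)
    (hsym : ∀ (f : Equiv.Perm (Fin d)) (n : Fin d → ℕ),
      (μ (y fun i => n (f i))).shape = fun i => (μ (y n)).shape (f i)) :
    ∃ w, HasWidth μ y w ∧ ∀ m, ∃ k, m < (cum w)^[k] 1 := by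
  obtain ⟨hpre, hcov⟩ := hlim
  -- arbitrarily large prefixes of `y` have images that are prefixes of `y`
  have key : ∀ N : ℕ, ∃ k P R, IsIterate μ a k P ∧ IsIterate μ a (k + 1) R ∧
      IsImage μ P R ∧ ∀ i, N < P.shape i := by
    intro N
    obtain ⟨k, P, hP, hN⟩ := hcov fun _ => N
    obtain ⟨R, hR⟩ := hM a (k + 1)
    obtain _ | ⟨hP', hPR⟩ := id hR
    rename_i P'
    exact ⟨k, P', R, hP', hR, hPR, fun i => by
      rw [← hP.shape_unique hpre hP']; exact hN i⟩
  -- widths in direction `i` depend on the `i`th coordinate only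
  have hw0 : ∀ n n' i, n i = n' i → (μ (y n)).shape i = (μ (y n')).shape i := by
    intro n n' i hi
    obtain ⟨k, P, R, hP, -, ⟨v, hv, -⟩, hN⟩ := key (∑ i, (n i + n' i))
    have hlt : ∀ j, n j + n' j < P.shape j := fun j =>
      (Finset.single_le_sum (f := fun j => n j + n' j) (fun _ _ => Nat.zero_le _)
        (Finset.mem_univ j)).trans_lt (hN j)
    have e := hv (fun j => ⟨n j, by have := hlt j; omega⟩) i
    have e' := hv (fun j => ⟨n' j, by have := hlt j; omega⟩) i
    rw [hpre k P hP] at e e'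
    simp only [hi] at e e'
    rw [e, e']
  -- a transposition carries the width in the first direction to any other direction
  let i₀ : Fin d := ⟨0, hd⟩
  let w : ℕ → ℕ := fun k => (μ (y fun _ => k)).shape i₀
  have hshape : ∀ n i, (μ (y n)).shape i = w (n i) := by
    intro n i
    rw [hw0 n (fun _ => n i) i rfl]
    have := congrFun (hsym (Equiv.swap i₀ i) fun _ => n i) i₀
    simp only [Equiv.swap_apply_left] at this
    exact this.symm
  refine ⟨w, ⟨hshape, fun n j => ?_⟩, fun m => ?_⟩
  · obtain ⟨k, P, R, hP, hR, ⟨v, hv, hs, he⟩, hN⟩ := key (∑ i, n i)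
    have hlt : ∀ j, n j < P.shape j := fun j =>
      (Finset.single_le_sum (fun _ _ => Nat.zero_le _) (Finset.mem_univ j)).trans_lt (hN j)
    let p : ∀ i, Fin (P.shape i) := fun i => ⟨n i, hlt i⟩
    have hvw : ∀ i, ∀ t < P.shape i, v i t = w t := by
      intro i t ht
      have := hv (Function.update p i ⟨t, ht⟩) i
      rw [hpre k P hP, hshape] at this
      simpa using this.symm
    have hcv : ∀ i, cum (v i) (n i) = cum w (n i) := fun i =>
      cum_congr fun t ht => hvw i t (ht.trans (hlt i))
    have hjw : ∀ i, (j i : ℕ) < v i (n i) := fun i => by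
      rw [hvw i _ (hlt i), ← hshape]; exact (j i).2
    have hPe : P.entry p = y n := hpre k P hP p
    have aux : ∀ b (hb : b = P.entry p) (j : ∀ i, Fin ((μ b).shape i))
        (_ : ∀ i, (j i : ℕ) < v i (n i)),
        y (fun i => cum w (n i) + j i) = (μ b).entry j := by
      rintro b rfl j hj
      have hR' : ∀ i, cum w (n i) + j i < R.shape i := fun i => by
        rw [hs, ← hcv]; exact cum_add_lt_cum (hlt i) (hj i)
      rw [← he p j (fun i => ⟨cum w (n i) + j i, hR' i⟩) fun i => by
        simp only [← hcv]; rfl]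
      exact (hpre _ R hR fun i => ⟨cum w (n i) + j i, hR' i⟩).symm
    exact aux _ hPe.symm j hjw
  · obtain ⟨k, P, hP, hm⟩ := hcov fun _ => m
    exact ⟨k, by rw [← hP.shape_eq hpre hshape i₀]; exact hm i₀⟩

/-- Conversely, a word with positive widths, the first being at least `2`, is a shape-symmetric
fixed point. -/
theorem isShapeSymmetric_of_hasWidth {μ : B → Picture d B} {y : (Fin d → ℕ) → B} {w : ℕ → ℕ}
    (hM : IsMorphism μ) (hw : HasWidth μ y w) (h1 : ∀ n, 1 ≤ w n) (h0 : 2 ≤ w 0) :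
    IsShapeSymmetric y := by
  have hpos : ∀ i, 0 < (μ (y 0)).shape i := fun i => by
    rw [hw.shape_eq]; exact h1 _
  have hpre : ∀ k P, IsIterate μ (y 0) k P → P.IsPrefix y := by
    intro k P h
    induction h with
    | zero =>
      intro n
      have : (fun i => (n i : ℕ)) = 0 := by
        funext i
        have := (n i).2
        simp only [Picture.letter] at this
        simp only [Pi.zero_apply]
        omega
      rw [this]; rfl
    | @succ k P R hP hR ih =>
      obtain ⟨v, hv, hs, he⟩ := hR
      intro n
      have hdec : ∀ i, ∃ p < P.shape i, ∃ j < v i p, (n i : ℕ) = cum (v i) p + j :=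
        fun i => exists_eq_cum_add (lt_of_lt_of_eq (n i).2 (hs i))
      choose p hp j hj e using hdec
      let p' : ∀ i, Fin (P.shape i) := fun i => ⟨p i, hp i⟩
      have hvw : ∀ i, ∀ t < P.shape i, v i t = w t := by
        intro i t ht
        have := hv (Function.update p' i ⟨t, ht⟩) i
        rw [ih, hw.shape_eq] at this
        simpa using this.symm
      rw [he p' (fun i => ⟨j i, by rw [hv]; exact hj i⟩) n e]
      have hn : (fun i => (n i : ℕ)) = fun i => cum w (p i) + j i := by
        funext i
        rw [e, cum_congr fun t ht => hvw i t (ht.trans (hp i))]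
      rw [hn]
      have hPe : P.entry p' = y p := ih p'
      have aux : ∀ b (hb : b = y p) (h : ∀ i, j i < (μ b).shape i),
          (μ b).entry (fun i => ⟨j i, h i⟩) = y fun i => cum w (p i) + j i := by
        rintro b rfl h
        exact (hw.entry_eq p _).symm
      exact aux _ hPe _
  refine ⟨μ, y 0, hM, ⟨hpos, ?_⟩, ⟨hpre, fun m => ?_⟩, fun f n => ?_⟩
  · rw [← hw.entry_eq 0]
    simp [Pi.zero_def]
  · obtain ⟨P, hP⟩ := hM (y 0) (∑ i, m i)
    refine ⟨_, P, hP, fun i => ?_⟩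
    rw [hP.shape_eq hpre hw.shape_eq]
    exact (Finset.single_le_sum (fun _ _ => Nat.zero_le _) (Finset.mem_univ i)).trans_lt
      (lt_iterate_cum h1 h0 _)
  · funext i
    rw [hw.shape_eq, hw.shape_eq]

/-! ### Morphisms of product type -/

section Product

variable {C E : Type}

/-- The map on letters `(c₁, …, c_d, e)` given by `d` synchronous one-dimensional rules: the side
length in direction `i` is `w cᵢ`, the `i`th component of the letter at offset `j` is
`F cᵢ jᵢ`, and the last component is given by `G`. -/
def productMap (w : C → ℕ) (hw : ∀ c, 1 ≤ w c) (F : C → ℕ → C)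
    (G : (Fin d → C) × E → (Fin d → ℕ) → E) (b : (Fin d → C) × E) :
    Picture d ((Fin d → C) × E) where
  shape := fun i => w (b.1 i)
  shape_pos_or_zero := Or.inl fun _ => hw _
  entry := fun j => (fun i => F (b.1 i) (j i), G b fun i => j i)

theorem isMorphism_productMap (w : C → ℕ) (hw : ∀ c, 1 ≤ w c) (F : C → ℕ → C)
    (G : (Fin d → C) × E → (Fin d → ℕ) → E) : IsMorphism (productMap w hw F G) := by
  intro a k
  -- in an iterate, the `i`th component of a letter depends on its `i`th coordinate only
  suffices h : ∃ P, IsIterate (productMap w hw F G) a k P ∧ (∀ i, 0 < P.shape i) ∧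
      ∃ κ : Fin d → ℕ → C, ∀ p i, (P.entry p).1 i = κ i (p i) by
    obtain ⟨P, hP, -⟩ := h
    exact ⟨P, hP⟩
  induction k with
  | zero =>
    exact ⟨_, IsIterate.zero, fun _ => one_pos, fun i _ => a.1 i, fun _ _ => rfl⟩
  | succ k ih =>
    obtain ⟨P, hP, hpos, κ, hκ⟩ := ih
    have hdec : ∀ i, ∀ m : Fin (cum (fun k => w (κ i k)) (P.shape i)),
        ∃ p < P.shape i, ∃ j < w (κ i p), (m : ℕ) = cum (fun k => w (κ i k)) p + j :=
      fun i m => exists_eq_cum_add m.2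
    choose p hp j hj e using hdec
    have hpos' : ∀ i, 0 < cum (fun k => w (κ i k)) (P.shape i) := fun i => by
      have := cum_add_lt_cum (w := fun k => w (κ i k)) (j := 0) (hpos i) (hw _)
      omega
    let R : Picture d ((Fin d → C) × E) :=
      { shape := fun i => cum (fun k => w (κ i k)) (P.shape i)
        shape_pos_or_zero := Or.inl hpos'
        entry := fun n =>
          (fun i => F (κ i (p i (n i))) (j i (n i)),
            G (P.entry fun i => ⟨p i (n i), hp i (n i)⟩) fun i => j i (n i)) }
    refine ⟨R, hP.succ ⟨fun i k => w (κ i k), ?_, fun i => rfl, ?_⟩, hpos',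
      fun i m => if h : m < cum (fun k => w (κ i k)) (P.shape i) then
        F (κ i (p i ⟨m, h⟩)) (j i ⟨m, h⟩) else a.1 i, ?_⟩
    · intro q i
      simp only [productMap]
      rw [hκ]
    · intro q t n hn
      have ht : ∀ i, (t i : ℕ) < w (κ i (q i)) := fun i => by
        rw [← hκ q i]; exact (t i).2
      have hun : ∀ i, p i (n i) = q i ∧ j i (n i) = t i := fun i =>
        cum_add_inj (hj i (n i)) (ht i) ((e i (n i)).symm.trans (hn i))
      have hq : (fun i => (⟨p i (n i), hp i (n i)⟩ : Fin (P.shape i))) = q := by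
        funext i
        exact Fin.ext (hun i).1
      simp only [R, productMap]
      rw [hq]
      refine Prod.ext ?_ ?_
      · funext i
        simp only [hκ, (hun i).1, (hun i).2]
      · simp only [fun i => (hun i).2]
    · intro n i
      have := (n i).2
      simp only [R] at this ⊢
      simp [this]

end Product

/-! ### Columns of tuples of words -/

/-- The first `m` columns of a tuple of words read in parallel, `e` being read beyond the end of
a word. -/
def cols {d : ℕ} {X : Type} (e : X) (m : ℕ) (u : Fin d → List X) : List (Fin d → X) :=
  (List.range m).map fun t i => (u i).getD t e

theorem cols_succ {d : ℕ} {X : Type} (e : X) (m : ℕ) (u : Fin d → List X) :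
    cols e (m + 1) u = (fun i => (u i).headD e) :: cols e m fun i => (u i).tail := by
  simp only [cols, List.range_succ_eq_map, List.map_cons, List.map_map]
  congr 1
  · funext i
    cases u i <;> rfl
  · refine List.map_congr_left fun t _ => ?_
    funext i
    simp only [Function.comp]
    cases u i <;> simp

theorem cols_map {d : ℕ} {X Y : Type} (f : X → Y) (e : X) (m : ℕ) (u : Fin d → List X) :
    (cols e m u).map (fun c i => f (c i)) = cols (f e) m fun i => (u i).map f := by
  simp only [cols, List.map_map]
  refine List.map_congr_left fun t _ => ?_
  funext i
  simp

theorem cols_append {d : ℕ} {X : Type} (e : X) (m k : ℕ) (u v : Fin d → List X)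
    (hu : ∀ i, (u i).length = m) :
    cols e (m + k) (fun i => u i ++ v i) = cols e m u ++ cols e k v := by
  simp only [cols, List.range_add, List.map_append, List.map_map]
  congr 1
  · refine List.map_congr_left fun t ht => ?_
    funext i
    rw [List.mem_range] at ht
    exact List.getD_append _ _ _ _ (by rw [hu]; exact ht)
  · refine List.map_congr_left fun t ht => ?_
    funext i
    simp only [Function.comp]
    rw [List.getD_append_right _ _ _ _ (by rw [hu]; omega), hu]
    congr 1
    omega

/-- The word `w` over `A`, padded on the left with `# = none` to length `m`. -/
def padTo {A : Type} (m : ℕ) (w : List A) : List (Option A) :=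
  List.replicate (m - w.length) none ++ w.map some

theorem length_padTo {A : Type} {m : ℕ} {w : List A} (h : w.length ≤ m) :
    (padTo m w).length = m := by
  simp only [padTo, List.length_append, List.length_replicate, List.length_map]
  omega

theorem padTuple_eq_cols {d : ℕ} {A : Type} (w : Fin d → List A) :
    padTuple w = cols none (Finset.univ.sup fun i => (w i).length) fun i =>
      padTo (Finset.univ.sup fun i => (w i).length) (w i) := by
  simp only [padTuple, cols, padTo]
  refine List.ext_getElem (by simp) fun t h₁ h₂ => ?_
  simp

/-! ### Numeration systems with a prescribed order isomorphism -/

theorem genealogical_trichotomous {A : Type} [LinearOrder A] {u v : List A} (h : u ≠ v) :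
    Genealogical u v ∨ Genealogical v u := by
  by_contra hc
  push Not at hc
  exact h (Std.Trichotomous.trichotomous (r := List.Shortlex (α := A) (· < ·)) _ _ hc.1 hc.2)

/-- The valuation is the only increasing map from the language onto `ℕ`. -/
theorem val_eq_of_strictMono {A : Type} [LinearOrder A] (S : NumerationSystem A)
    (f : {w : List A // w ∈ S.lang} → ℕ) (hf : Function.Surjective f)
    (hm : ∀ v w, Genealogical v.1 w.1 → f v < f w) : S.val = f := by
  have hlt : ∀ v w, Genealogical v.1 w.1 ↔ f v < f w := by
    refine fun v w => ⟨hm v w, fun h => ?_⟩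
    by_cases e : v.1 = w.1
    · rw [Subtype.ext e] at h
      exact absurd h (lt_irrefl _)
    · rcases genealogical_trichotomous e with h' | h'
      · exact h'
      · have := hm _ _ h'; omega
  have hinj : Function.Injective f := by
    intro v w h
    by_contra hne
    rcases genealogical_trichotomous (fun e => hne (Subtype.ext e)) with h' | h' <;>
    · have := hm _ _ h'; omega
  funext w
  have : {v : {w : List A // w ∈ S.lang} | Genealogical v.1 w.1} = f ⁻¹' Set.Iio (f w) := by
    ext v
    exact hlt v w
  rw [NumerationSystem.val, this, ← Set.ncard_image_of_injective _ hinj,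
    Set.image_preimage_eq _ hf]
  simp [Set.ncard_eq_toFinset_card']

theorem rep_val {A : Type} [LinearOrder A] [Finite A] (S : NumerationSystem A)
    (w : {w : List A // w ∈ S.lang}) : S.rep (S.val w) = w.1 := by
  have := (Equiv.ofBijective S.val S.val_bijective).symm_apply_apply w
  simp only [Equiv.ofBijective_apply] at this
  rw [NumerationSystem.rep, this]

theorem rep_mem {A : Type} [LinearOrder A] [Finite A] (S : NumerationSystem A) (n : ℕ) :
    S.rep n ∈ S.lang :=
  ((Equiv.ofBijective S.val S.val_bijective).symm n).2

theorem val_rep {A : Type} [LinearOrder A] [Finite A] (S : NumerationSystem A) (n : ℕ) :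
    S.val ⟨S.rep n, rep_mem S n⟩ = n :=
  (Equiv.ofBijective S.val S.val_bijective).apply_symm_apply n

/-! ### Addresses in the tree of a width function -/

/-- In the tree in which the children of `n` are `cum w n + j` with `j < w n`, the word `u` is the
sequence of ranks `j` along a branch from `n` downwards. -/
def IsAddress (w : ℕ → ℕ) : ℕ → List ℕ → Prop
  | _, [] => True
  | n, j :: u => j < w n ∧ IsAddress w (cum w n + j) u

/-- The node reached from `n` along the address `u`. -/
def node (w : ℕ → ℕ) : ℕ → List ℕ → ℕ
  | n, [] => n
  | n, j :: u => node w (cum w n + j) u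

theorem isAddress_append {w : ℕ → ℕ} {n : ℕ} {u v : List ℕ} :
    IsAddress w n (u ++ v) ↔ IsAddress w n u ∧ IsAddress w (node w n u) v := by
  induction u generalizing n with
  | nil => simp [IsAddress, node]
  | cons j u ih => simp [IsAddress, node, ih, and_assoc]

theorem node_append {w : ℕ → ℕ} {n : ℕ} {u v : List ℕ} :
    node w n (u ++ v) = node w (node w n u) v := by
  induction u generalizing n with
  | nil => simp [node]
  | cons j u ih => simp [node, ih]

theorem node_lt_node {w : ℕ → ℕ} {n n' : ℕ} {u v : List ℕ} (hl : u.length = v.length)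
    (hu : IsAddress w n u) (h : n < n') : node w n u < node w n' v := by
  induction u generalizing n n' v with
  | nil =>
    obtain rfl : v = [] := List.length_eq_zero_iff.1 hl.symm
    exact h
  | cons j u ih =>
    obtain _ | ⟨k, v⟩ := v
    · simp at hl
    · rw [node, node]
      exact ih (by simpa using hl) hu.2 ((cum_add_lt_cum h hu.1).trans_le (Nat.le_add_right _ _))

theorem node_lt_node_of_lex {w : ℕ → ℕ} {n : ℕ} {u v : List ℕ} (hl : u.length = v.length)
    (hu : IsAddress w n u) (h : List.Lex (· < ·) u v) : node w n u < node w n v := by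
  induction h generalizing n with
  | nil => simp at hl
  | rel h => rw [node, node]; exact node_lt_node (by simpa using hl) hu.2 (by omega)
  | cons h ih => rw [node, node]; exact ih (by simpa using hl) hu.2

/-- Every position that the iterates from the origin reach has an address. -/
theorem exists_address {w : ℕ → ℕ} {k m : ℕ} (h : m < (cum w)^[k] 1) :
    ∃ u, IsAddress w 0 u ∧ node w 0 u = m := by
  induction k generalizing m with
  | zero => exact ⟨[], trivial, by simp at h; simp [node, h]⟩
  | succ k ih =>
    rw [Function.iterate_succ_apply'] at h
    obtain ⟨p, hp, j, hj, rfl⟩ := exists_eq_cum_add h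
    obtain ⟨u, hu, rfl⟩ := ih hp
    refine ⟨u ++ [j], isAddress_append.2 ⟨hu, hj, trivial⟩, ?_⟩
    rw [node_append]; rfl

theorem isAddress_replicate_zero {w : ℕ → ℕ} (h0 : 0 < w 0) (r : ℕ) (u : List ℕ) :
    (IsAddress w 0 (List.replicate r 0 ++ u) ↔ IsAddress w 0 u) ∧
      node w 0 (List.replicate r 0 ++ u) = node w 0 u := by
  induction r with
  | zero => simp
  | succ r ih => simpa [List.replicate_succ, IsAddress, node, h0] using ih

/-- Every node has an address without leading zero. -/
theorem exists_address_head_ne_zero {w : ℕ → ℕ} (h0 : 0 < w 0) {u : List ℕ}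
    (hu : IsAddress w 0 u) : ∃ v, IsAddress w 0 v ∧ v.head? ≠ some 0 ∧ node w 0 v = node w 0 u := by
  induction u with
  | nil => exact ⟨[], hu, by simp, rfl⟩
  | cons j u ih =>
    by_cases hj : j = 0
    · subst hj
      have h := isAddress_replicate_zero h0 1 u
      obtain ⟨v, hv, hv', e⟩ := ih (h.1.1 hu)
      exact ⟨v, hv, hv', e.trans h.2.symm⟩
    · exact ⟨_, hu, by simpa using hj, rfl⟩

/-- For addresses without leading zero, the genealogical order is the order of the nodes. -/
theorem node_lt_node_of_shortlex {w : ℕ → ℕ} (h0 : 0 < w 0) {u v : List ℕ}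
    (hu : IsAddress w 0 u) (hv0 : v.head? ≠ some 0)
    (h : List.Shortlex (· < ·) u v) : node w 0 u < node w 0 v := by
  rw [List.shortlex_def] at h
  rcases h with h | ⟨hl, h⟩
  · -- padded with zeros to the length of `v`, the word `u` becomes lexicographically smaller
    obtain ⟨r, hr⟩ : ∃ r, v.length = r + 1 + u.length := ⟨v.length - 1 - u.length, by omega⟩
    have hz := isAddress_replicate_zero h0 (r + 1) u
    rw [← hz.2]
    refine node_lt_node_of_lex (by simp [hr]) (hz.1.2 hu) ?_
    obtain _ | ⟨k, v⟩ := v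
    · simp at h
    · rw [List.replicate_succ, List.cons_append]
      exact List.Lex.rel (Nat.pos_of_ne_zero (by simpa using hv0))
  · exact node_lt_node_of_lex hl hu h

/-! ### Shape-symmetric words are automatic -/

open Classical in
/-- The letter of the picture `P` at position `n`, if there is one. -/
noncomputable def Picture.get? (P : Picture d B) (n : Fin d → ℕ) : Option B :=
  if h : ∀ i, n i < P.shape i then some (P.entry fun i => ⟨n i, h i⟩) else none

theorem HasWidth.get?_eq {μ : B → Picture d B} {y : (Fin d → ℕ) → B} {w : ℕ → ℕ}
    (hw : HasWidth μ y w) {n j : Fin d → ℕ} (hj : ∀ i, j i < w (n i)) :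
    (μ (y n)).get? j = some (y fun i => cum w (n i) + j i) := by
  have h : ∀ i, j i < (μ (y n)).shape i := fun i => by rw [hw.shape_eq]; exact hj i
  rw [Picture.get?, dif_pos h, ← hw.entry_eq n fun i => ⟨j i, h i⟩]

theorem HasWidth.get?_eq_none {μ : B → Picture d B} {y : (Fin d → ℕ) → B} {w : ℕ → ℕ}
    (hw : HasWidth μ y w) {n j : Fin d → ℕ} {i : Fin d} (hj : w (n i) ≤ j i) :
    (μ (y n)).get? j = none := by
  rw [Picture.get?, dif_neg]
  intro h
  have := h i
  rw [hw.shape_eq] at this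
  omega

/-- The transition function of the automaton whose states are the letters and a sink, and which
reads a letter of `μ b` off its position. -/
noncomputable def pictureStep (μ : B → Picture d B) (q : Option B) (j : Fin d → ℕ) : Option B :=
  q.bind fun b => (μ b).get? j

/-- Reading the digits of addresses in parallel leads from the letter at `n` to the letter at the
nodes that have these addresses. -/
theorem HasWidth.foldl_pictureStep {μ : B → Picture d B} {y : (Fin d → ℕ) → B} {w : ℕ → ℕ}
    (hw : HasWidth μ y w) {m : ℕ} {u : Fin d → List ℕ} {n : Fin d → ℕ}
    (hl : ∀ i, (u i).length = m) (hu : ∀ i, IsAddress w (n i) (u i)) :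
    (cols 0 m u).foldl (pictureStep μ) (some (y n)) = some (y fun i => node w (n i) (u i)) := by
  induction m generalizing u n with
  | zero =>
    have : u = fun _ => [] := funext fun i => List.length_eq_zero_iff.1 (hl i)
    subst this
    simp [cols, node]
  | succ m ih =>
    rw [cols_succ, List.foldl_cons]
    have hc : ∀ i, ∃ j v, u i = j :: v := fun i => List.exists_cons_of_length_eq_add_one (hl i)
    choose j v hjv using hc
    obtain rfl : u = fun i => j i :: v i := funext hjv
    simp only [List.headD_cons, List.tail_cons, pictureStep, Option.bind_some]
    rw [hw.get?_eq fun i => (hu i).1]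
    exact ih (fun i => by simpa using hl i) fun i => (hu i).2

theorem foldl_pictureStep_none (μ : B → Picture d B) (v : List ℕ) :
    v.foldl (fun q j => pictureStep μ q fun _ => j) none = none := by
  induction v with
  | nil => rfl
  | cons k v ih => simpa [pictureStep] using ih

/-- Along the diagonal of `y`, the automaton stays away from its sink exactly on addresses. -/
theorem HasWidth.foldl_diagonal_isSome {μ : B → Picture d B} {y : (Fin d → ℕ) → B} {w : ℕ → ℕ}
    (hw : HasWidth μ y w) (hd : 1 ≤ d) (n : ℕ) (u : List ℕ) :
    ((u.foldl (fun q j => pictureStep μ q fun _ => j) (some (y fun _ => n))).isSome ↔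
      IsAddress w n u) := by
  induction u generalizing n with
  | nil => simp [IsAddress]
  | cons j u ih =>
    rw [List.foldl_cons]
    by_cases hj : j < w n
    · rw [pictureStep, Option.bind_some, hw.get?_eq fun _ => hj, ih]
      simp [IsAddress, hj]
    · rw [pictureStep, Option.bind_some,
        hw.get?_eq_none (i := ⟨0, hd⟩) (not_lt.1 hj)]
      simp [IsAddress, hj, foldl_pictureStep_none]

/-- The automaton recognizing the addresses without leading zero; the Boolean marks the
beginning of the word. -/
noncomputable def addressDFA (μ : B → Picture d B) (a : B) (K : ℕ) :
    DFA (Fin K) (Bool × Option B) where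
  step := fun q j => (false, if q.1 = true ∧ (j : ℕ) = 0 then none else
    pictureStep μ q.2 fun _ => j)
  start := (true, some a)
  accept := {q | q.2.isSome}

theorem foldl_addressDFA (μ : B → Picture d B) (a : B) (K : ℕ) (q : Option B)
    (u : List (Fin K)) :
    (u.foldl (addressDFA μ a K).step (false, q)).2 =
      (u.map Fin.val).foldl (fun q j => pictureStep μ q fun _ => j) q := by
  induction u generalizing q with
  | nil => rfl
  | cons j u ih =>
    rw [List.foldl_cons, List.map_cons, List.foldl_cons, ← ih]
    simp [addressDFA]

theorem mem_accepts_addressDFA {μ : B → Picture d B} {y : (Fin d → ℕ) → B} {w : ℕ → ℕ}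
    (hw : HasWidth μ y w) (hd : 1 ≤ d) {K : ℕ} {u : List (Fin K)} :
    u ∈ (addressDFA μ (y fun _ => 0) K).accepts ↔
      IsAddress w 0 (u.map Fin.val) ∧ (u.map Fin.val).head? ≠ some 0 := by
  rw [← hw.foldl_diagonal_isSome hd 0]
  change (u.foldl (addressDFA μ (y fun _ => 0) K).step _).2.isSome = true ↔ _
  obtain _ | ⟨j, u⟩ := u
  · simp [addressDFA]
  · rw [List.foldl_cons]
    by_cases hj : (j : ℕ) = 0
    · have h1 : (addressDFA μ (y fun _ => 0) K).step (addressDFA μ (y fun _ => 0) K).start j =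
          (false, none) := by simp [addressDFA, hj]
      rw [h1, foldl_addressDFA, foldl_pictureStep_none]
      simp [hj]
    · have h1 : (addressDFA μ (y fun _ => 0) K).step (addressDFA μ (y fun _ => 0) K).start j =
          (false, pictureStep μ (some (y fun _ => 0)) fun _ => j) := by simp [addressDFA, hj]
      rw [h1, foldl_addressDFA]
      simp [hj]

/-- The numeration system is the language of addresses without leading zero in the tree of the
width function, and the automaton reads these addresses with the padding letter as digit `0`. -/
theorem isAutomaticFor_of_isShapeSymmetric {Γ : Type*} [Finite B] (hd : 1 ≤ d)
    {y : (Fin d → ℕ) → B} (ν : B → Γ) (hy : IsShapeSymmetric y) :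
    ∃ (A : Type) (_ : LinearOrder A) (_ : Finite A) (S : NumerationSystem A),
      [] ∈ S.lang ∧ IsAutomaticFor S fun n => ν (y n) := by
  obtain ⟨μ, a, hM, hpro, hlim, hsym⟩ := hy
  obtain ⟨w, hw, hgrow⟩ := exists_hasWidth hd hM hlim hsym
  have hy0 : y (fun _ => 0) = a := (hlim.1 0 _ IsIterate.zero fun _ => ⟨0, one_pos⟩).symm
  have h0 : 0 < w 0 := by
    obtain ⟨h, -⟩ := hpro
    have := h ⟨0, hd⟩
    rwa [← hy0, hw.shape_eq] at this
  obtain ⟨K, hK⟩ : ∃ K, ∀ n, w n < K := by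
    obtain ⟨K, hK⟩ := (Set.finite_range fun b => (μ b).shape ⟨0, hd⟩).bddAbove
    refine ⟨K + 1, fun n => Nat.lt_succ_of_le (hK ⟨y fun _ => n, ?_⟩)⟩
    simp [hw.shape_eq]
  -- widths are below `K`, so that all digits of addresses are letters of `Fin K`
  have lift : ∀ n u, IsAddress w n u → ∃ v : List (Fin K), v.map Fin.val = u := by
    intro n u hu
    induction u generalizing n with
    | nil => exact ⟨[], rfl⟩
    | cons j u ih =>
      obtain ⟨v, rfl⟩ := ih _ hu.2
      exact ⟨⟨j, hu.1.trans (hK n)⟩ :: v, rfl⟩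
  have hmem := fun u : List (Fin K) => mem_accepts_addressDFA hw hd (u := u)
  have hsurj : ∀ m, ∃ u ∈ (addressDFA μ (y fun _ => 0) K).accepts,
      node w 0 (u.map Fin.val) = m := by
    intro m
    obtain ⟨k, hk⟩ := hgrow m
    obtain ⟨u, hu, rfl⟩ := exists_address hk
    obtain ⟨v, hv, hv', e⟩ := exists_address_head_ne_zero h0 hu
    obtain ⟨v, rfl⟩ := lift _ _ hv
    exact ⟨v, (hmem v).2 ⟨hv, hv'⟩, e⟩
  have : Fintype B := Fintype.ofFinite B
  let S : NumerationSystem (Fin K) :=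
    { lang := (addressDFA μ (y fun _ => 0) K).accepts
      isRegular := ⟨_, inferInstance, _, rfl⟩
      infinite := by
        refine Set.Infinite.of_image (fun u => node w 0 (u.map Fin.val)) ?_
        convert Set.infinite_univ (α := ℕ)
        exact Set.eq_univ_of_forall hsurj }
  have hval : S.val = fun u => node w 0 (u.1.map Fin.val) := by
    refine val_eq_of_strictMono S _ (fun m => ?_) fun u v huv => ?_
    · obtain ⟨u, hu, e⟩ := hsurj m
      exact ⟨⟨u, hu⟩, e⟩
    · refine node_lt_node_of_shortlex h0 ((hmem _).1 u.2).1 ((hmem _).1 v.2).2 ?_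
      rw [Genealogical, List.shortlex_def] at huv
      rw [List.shortlex_def]
      simp only [List.length_map]
      refine huv.imp id fun h => ⟨h.1, ?_⟩
      have hlex := h.2
      clear h huv
      revert hlex
      generalize u.1 = u
      generalize v.1 = v
      intro hlex
      induction hlex with
      | nil => exact List.Lex.nil
      | rel h => exact List.Lex.rel h
      | cons _ ih => exact List.Lex.cons ih
  let dig : Option (Fin K) → ℕ := fun c => c.elim 0 Fin.val
  refine ⟨Fin K, inferInstance, inferInstance, S, (hmem []).2 ⟨trivial, by simp⟩, Option B,
    inferInstance, ⟨fun q c => pictureStep μ q fun i => dig (c i), some a,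
      fun q => q.elim (ν a) ν⟩, fun n => ?_⟩
  have hrep : ∀ k, IsAddress w 0 ((S.rep k).map Fin.val) ∧
      node w 0 ((S.rep k).map Fin.val) = k := fun k =>
    ⟨((hmem _).1 (rep_mem S k)).1, by
      have := val_rep S k
      rwa [hval] at this⟩
  rw [DFAO.output, padTuple_eq_cols]
  set m := Finset.univ.sup fun i => (S.rep (n i)).length with hm
  have hle : ∀ i, (S.rep (n i)).length ≤ m := fun i =>
    Finset.le_sup (f := fun i => (S.rep (n i)).length) (Finset.mem_univ i)
  have hdig : ∀ v : List (Fin K), (padTo m v).map dig =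
      List.replicate (m - v.length) 0 ++ v.map Fin.val := by
    intro v
    simp [padTo, dig, Function.comp_def]
  have key := hw.foldl_pictureStep (m := m) (n := fun _ => 0)
    (u := fun i => (padTo m (S.rep (n i))).map dig)
    (fun i => by rw [List.length_map, length_padTo (hle i)])
    fun i => by
      rw [hdig, (isAddress_replicate_zero h0 _ _).1]; exact (hrep _).1
  rw [show (0 : ℕ) = dig none from rfl, ← cols_map, List.foldl_map] at key
  simp only [hdig, show dig none = 0 from rfl, (isAddress_replicate_zero h0 _ _).2,
    (hrep _).2, hy0] at key
  simp only [key, Option.elim_some]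

/-! ### Accepted words in lexicographic order -/

section Words

variable {X Q : Type}

/-- All words of length `m` over the list of letters `s`, in lexicographic order. -/
def allWords (s : List X) : ℕ → List (List X)
  | 0 => [[]]
  | m + 1 => s.flatMap fun a => (allWords s m).map (a :: ·)

theorem mem_allWords {s : List X} (hs : ∀ a, a ∈ s) {m : ℕ} {u : List X} :
    u ∈ allWords s m ↔ u.length = m := by
  induction m generalizing u with
  | zero => simp [allWords]
  | succ m ih =>
    simp only [allWords, List.mem_flatMap, List.mem_map, ih]
    constructor
    · rintro ⟨a, -, v, rfl, rfl⟩
      rfl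
    · intro h
      obtain ⟨a, v, rfl⟩ := List.exists_cons_of_length_eq_add_one h
      exact ⟨a, hs a, v, by simpa using h, rfl⟩

theorem allWords_add (s : List X) (m k : ℕ) :
    allWords s (m + k) = (allWords s m).flatMap fun u => (allWords s k).map (u ++ ·) := by
  induction m with
  | zero => simp [allWords]
  | succ m ih =>
    rw [Nat.add_right_comm]
    simp only [allWords, ih, List.flatMap_assoc, List.map_flatMap, List.flatMap_map, List.map_map]
    rfl

theorem pairwise_allWords {r : X → X → Prop} {s : List X} (hs : s.Pairwise r) (m : ℕ) :
    (allWords s m).Pairwise (List.Lex r) := by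
  induction m with
  | zero => simp [allWords]
  | succ m ih =>
    rw [allWords, List.pairwise_flatMap]
    refine ⟨fun a _ => ?_, hs.imp fun h => ?_⟩
    · rw [List.pairwise_map]
      exact ih.imp fun h => List.Lex.cons h
    · simp only [List.mem_map]
      rintro _ ⟨u, -, rfl⟩ _ ⟨v, -, rfl⟩
      exact List.Lex.rel h

open Classical in
/-- The words of length `m` that `D` accepts from the state `q`, in lexicographic order. -/
noncomputable def words (D : DFA X Q) (s : List X) (m : ℕ) (q : Q) : List (List X) :=
  (allWords s m).filter fun u => D.evalFrom q u ∈ D.accept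

theorem mem_words {D : DFA X Q} {s : List X} (hs : ∀ a, a ∈ s) {m : ℕ} {q : Q} {u : List X} :
    u ∈ words D s m q ↔ u.length = m ∧ D.evalFrom q u ∈ D.accept := by
  simp [words, mem_allWords hs]

theorem words_add (D : DFA X Q) (s : List X) (m k : ℕ) (q : Q) :
    words D s (m + k) q =
      (allWords s m).flatMap fun u => (words D s k (D.evalFrom q u)).map (u ++ ·) := by
  simp only [words, allWords_add, List.filter_flatMap, List.filter_map]
  congr 1
  funext u
  congr 2
  funext v
  simp [DFA.evalFrom_of_append]

/-- The words `u` of length `M` over `s`, each paired with the ranks of the words of length `i`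
that `D` accepts from the state reached on `u`. The list has one entry for each word of
`words D s (M + i) q`. -/
noncomputable def items (D : DFA X Q) (s : List X) (i M : ℕ) (q : Q) : List (List X × ℕ) :=
  (allWords s M).flatMap fun u =>
    (List.range (words D s i (D.evalFrom q u)).length).map (u, ·)

theorem items_add (D : DFA X Q) (s : List X) (i M p : ℕ) (q : Q) :
    items D s i (M + p) q = (allWords s M).flatMap fun u =>
      (items D s i p (D.evalFrom q u)).map fun z => (u ++ z.1, z.2) := by
  simp only [items, allWords_add, List.flatMap_assoc, List.map_flatMap, List.flatMap_map,
    List.map_map, DFA.evalFrom_of_append]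
  rfl

/-- The item `(u, t)` stands for the word `u v`, with `v` the accepted word of rank `t` after
`u`. -/
theorem words_add_eq_map_items (D : DFA X Q) (s : List X) (i M : ℕ) (q : Q) :
    words D s (M + i) q = (items D s i M q).map fun z =>
      z.1 ++ (words D s i (D.evalFrom q z.1)).getD z.2 [] := by
  simp only [words_add, items, List.map_flatMap, List.map_map]
  congr 1
  funext u
  refine List.ext_getElem (by simp) fun t h₁ h₂ => ?_
  simp at h₁
  simp [h₁]

theorem length_items (D : DFA X Q) (s : List X) (i M : ℕ) (q : Q) :
    (items D s i M q).length = (words D s (M + i) q).length := by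
  rw [words_add_eq_map_items, List.length_map]

theorem mem_items {D : DFA X Q} {s : List X} (hs : ∀ a, a ∈ s) {i M : ℕ} {q : Q}
    {z : List X × ℕ} : z ∈ items D s i M q ↔
      z.1.length = M ∧ z.2 < (words D s i (D.evalFrom q z.1)).length := by
  obtain ⟨u, t⟩ := z
  simp [items, mem_allWords hs]

end Words

/-! ### The representations as a list of padded words -/

section Padded

variable {A σ : Type}

/-- The automaton over the padded alphabet that accepts the words `#^r w` with `w` accepted by
`M`. Its states are a sink `none`, the state `some none` in which only padding has been read, and
the states of `M`. -/
def paddedDFA (M : DFA A σ) : DFA (Option A) (Option (Option σ)) where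
  step
    | some none, none => some none
    | some none, some a => some (some (M.step M.start a))
    | some (some q), some a => some (some (M.step q a))
    | _, _ => none
  start := some none
  accept := {q | (∃ q' ∈ M.accept, q = some (some q')) ∨ M.start ∈ M.accept ∧ q = some none}

theorem paddedDFA_evalFrom_sink (M : DFA A σ) (u : List (Option A)) :
    (paddedDFA M).evalFrom none u = none := by
  induction u with
  | nil => rfl
  | cons a u ih => rw [DFA.evalFrom_cons]; exact ih

theorem paddedDFA_evalFrom_run_mem_accept (M : DFA A σ) (q : σ) (u : List (Option A)) :
    (paddedDFA M).evalFrom (some (some q)) u ∈ (paddedDFA M).accept ↔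
      ∃ w : List A, u = w.map some ∧ M.evalFrom q w ∈ M.accept := by
  induction u generalizing q with
  | nil => simp [paddedDFA]
  | cons a u ih =>
    rw [DFA.evalFrom_cons]
    obtain _ | a := a
    · have : (paddedDFA M).step (some (some q)) none = none := rfl
      rw [this, paddedDFA_evalFrom_sink]
      refine iff_of_false (by simp [paddedDFA]) ?_
      rintro ⟨w, e, -⟩
      cases w <;> simp at e
    · have : (paddedDFA M).step (some (some q)) (some a) = some (some (M.step q a)) := rfl
      rw [this, ih]
      constructor
      · rintro ⟨w, rfl, h⟩
        exact ⟨a :: w, rfl, h⟩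
      · rintro ⟨w, e, h⟩
        obtain ⟨b, w, rfl, hb, rfl⟩ := List.map_eq_cons_iff.1 e.symm
        obtain rfl : b = a := by simpa using hb
        exact ⟨w, rfl, h⟩

theorem paddedDFA_eval_mem_accept (M : DFA A σ) (u : List (Option A)) :
    (paddedDFA M).evalFrom (some none) u ∈ (paddedDFA M).accept ↔
      ∃ w ∈ M.accepts, w.length ≤ u.length ∧ u = padTo u.length w := by
  induction u with
  | nil =>
    constructor
    · intro h
      refine ⟨[], ?_, by simp, by simp [padTo]⟩
      simpa [paddedDFA, DFA.mem_accepts] using h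
    · rintro ⟨w, hw, h, -⟩
      obtain rfl : w = [] := by simpa using h
      simpa [paddedDFA, DFA.mem_accepts] using hw
  | cons a u ih =>
    rw [DFA.evalFrom_cons]
    obtain _ | a := a
    · have : (paddedDFA M).step (some none) none = some none := rfl
      rw [this, ih]
      refine exists_congr fun w => and_congr_right fun hw => ?_
      constructor
      · rintro ⟨h, e⟩
        refine ⟨by simp; omega, ?_⟩
        rw [List.length_cons, padTo, Nat.sub_add_comm h, List.replicate_succ, List.cons_append]
        exact congrArg _ e
      · rintro ⟨h, e⟩
        by_cases h' : w.length ≤ u.length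
        · refine ⟨h', ?_⟩
          rw [List.length_cons, padTo, Nat.sub_add_comm h', List.replicate_succ,
            List.cons_append] at e
          exact (List.cons.inj e).2
        · obtain _ | ⟨b, w⟩ := w
          · simp at h'
          · simp only [List.length_cons] at h h'
            have : u.length = w.length := by omega
            simp [padTo, this] at e
    · have : (paddedDFA M).step (some none) (some a) = some (some (M.step M.start a)) := rfl
      rw [this, paddedDFA_evalFrom_run_mem_accept]
      constructor
      · rintro ⟨w, rfl, h⟩
        exact ⟨a :: w, h, by simp, by simp [padTo]⟩
      · rintro ⟨w, hw, h, e⟩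
        obtain hr | hr := Nat.eq_zero_or_pos ((some a :: u).length - w.length)
        · rw [padTo, hr, List.replicate_zero, List.nil_append] at e
          obtain ⟨b, w, rfl, hb, rfl⟩ := List.map_eq_cons_iff.1 e.symm
          obtain rfl : b = a := by simpa using hb
          exact ⟨w, rfl, hw⟩
        · rw [padTo, ← Nat.succ_pred_eq_of_pos hr, List.replicate_succ] at e
          simp at e

theorem paddedDFA_evalFrom_replicate_none (M : DFA A σ) (r : ℕ) (u : List (Option A)) :
    (paddedDFA M).evalFrom (some none) (List.replicate r none ++ u) =
      (paddedDFA M).evalFrom (some none) u := by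
  induction r with
  | zero => rfl
  | succ r ih => rw [List.replicate_succ, List.cons_append, DFA.evalFrom_cons]; exact ih

theorem reduceOption_padTo (m : ℕ) (w : List A) : (padTo m w).reduceOption = w := by
  simp [padTo, List.reduceOption, List.filterMap_map]

variable [LinearOrder A]

/-- The order on padded letters, the padding being smaller than all letters. -/
def padLt : Option A → Option A → Prop
  | none, some _ => True
  | some a, some b => a < b
  | _, _ => False

variable (A) in
/-- The padded letters, in increasing order. -/
noncomputable def padLetters [Finite A] : List (Option A) :=
  have := Fintype.ofFinite A
  none :: (Finset.univ.sort (α := A) (· ≤ ·)).map some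

theorem mem_padLetters [Finite A] (a : Option A) : a ∈ padLetters A := by
  cases a <;> simp [padLetters]

theorem pairwise_padLetters [Finite A] : (padLetters A).Pairwise padLt := by
  have := Fintype.ofFinite A
  simp only [padLetters, List.pairwise_cons, List.pairwise_map]
  refine ⟨?_, ?_⟩
  · intro a ha
    obtain ⟨b, -, rfl⟩ := List.mem_map.1 ha
    trivial
  · exact (Finset.sortedLT_sort _).pairwise

theorem lex_padLt_of_replicate_append {r : ℕ} {u v : List (Option A)}
    (h : List.Lex padLt (List.replicate r none ++ u) (List.replicate r none ++ v)) :
    List.Lex padLt u v := by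
  induction r with
  | zero => exact h
  | succ r ih =>
    rw [List.replicate_succ, List.cons_append, List.cons_append, List.cons_lex_cons_iff] at h
    exact ih (h.resolve_left id).2

theorem lex_of_lex_map_some {u v : List A} (h : List.Lex padLt (u.map some) (v.map some)) :
    List.Lex (· < ·) u v := by
  induction u generalizing v with
  | nil =>
    obtain _ | ⟨b, v⟩ := v
    · cases h
    · exact List.Lex.nil
  | cons a u ih =>
    obtain _ | ⟨b, v⟩ := v
    · cases h
    · rw [List.map_cons, List.map_cons, List.cons_lex_cons_iff] at h
      rcases h with h | ⟨e, h⟩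
      · exact List.Lex.rel h
      · obtain rfl := Option.some.inj e
        exact List.Lex.cons (ih h)

/-- On padded words of the same length, the lexicographic order is the genealogical order of the
underlying words. -/
theorem genealogical_of_lex_padTo {m : ℕ} {u v : List A} (hu : u.length ≤ m) (hv : v.length ≤ m)
    (h : List.Lex padLt (padTo m u) (padTo m v)) : Genealogical u v := by
  rw [Genealogical, List.shortlex_def]
  rcases lt_trichotomy u.length v.length with hl | hl | hl
  · exact Or.inl hl
  · rw [padTo, padTo, hl] at h
    exact Or.inr ⟨hl, lex_of_lex_map_some (lex_padLt_of_replicate_append h)⟩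
  · obtain ⟨e, he⟩ : ∃ e, m - v.length = (m - u.length) + (e + 1) :=
      ⟨u.length - v.length - 1, by omega⟩
    rw [padTo, padTo, he, List.replicate_add, List.append_assoc] at h
    have h := lex_padLt_of_replicate_append h
    obtain _ | ⟨a, u⟩ := u
    · simp at hl
    · rw [List.map_cons, List.replicate_succ, List.cons_append, List.cons_lex_cons_iff] at h
      rcases h with h | ⟨e, -⟩
      · exact h.elim
      · cases e

theorem genealogical_asymm {u v : List A} (h : Genealogical u v) : ¬ Genealogical v u :=
  Std.Asymm.asymm (r := List.Shortlex (α := A) (· < ·)) _ _ h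

/-- An increasing list of words of the language that is closed under predecessors enumerates the
first representations. -/
theorem rep_eq_getElem [Finite A] (S : NumerationSystem A) {l : List (List A)}
    (hl : l.Pairwise Genealogical) (hmem : ∀ w ∈ l, w ∈ S.lang)
    (hdown : ∀ w ∈ l, ∀ v ∈ S.lang, Genealogical v w → v ∈ l) {n : ℕ} (hn : n < l.length) :
    S.rep n = l[n] := by
  classical
  have hirr : ∀ u : List A, ¬ Genealogical u u := fun u h => genealogical_asymm h h
  have hnd : l.Nodup := hl.imp (S := (· ≠ ·)) fun {u v} h e => hirr u (by rwa [← e] at h)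
  suffices h : S.val ⟨l[n], hmem _ (List.getElem_mem hn)⟩ = n by
    have := rep_val S ⟨l[n], hmem _ (List.getElem_mem hn)⟩
    rwa [h] at this
  rw [List.pairwise_iff_getElem] at hl
  -- the words of the language preceding `l[n]` are the first `n` elements of `l`
  have hset : Subtype.val '' {v : {w : List A // w ∈ S.lang} | Genealogical v.1 l[n]} =
      ((l.take n).toFinset : Set (List A)) := by
    ext v
    simp only [Set.mem_image, Set.mem_ofPred_eq, Subtype.exists, exists_and_left, exists_prop,
      exists_eq_right_right, List.coe_toFinset]
    constructor
    · rintro ⟨hv, hvL⟩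
      obtain ⟨k, hk, rfl⟩ := List.mem_iff_getElem.1 (hdown _ (List.getElem_mem hn) v hvL hv)
      rcases lt_trichotomy k n with h | rfl | h
      · exact List.mem_take_iff_getElem.2 ⟨k, by omega, rfl⟩
      · exact absurd hv (hirr _)
      · exact absurd hv (genealogical_asymm (hl n k hn hk h))
    · intro hv
      obtain ⟨k, hk, rfl⟩ := List.mem_take_iff_getElem.1 hv
      exact ⟨hl k n (by omega) hn (by omega), hmem _ (List.getElem_mem _)⟩
  rw [NumerationSystem.val, ← Set.ncard_image_of_injective _ Subtype.val_injective, hset,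
    Set.ncard_coe_finset, List.toFinset_card_of_nodup (hnd.sublist (List.take_sublist n l)),
    List.length_take]
  omega

variable [Finite A]

/-- The padded words of length `m` accepted by the padded automaton are, in this order, the
representations of `0, 1, 2, …` of length at most `m`. -/
theorem words_paddedDFA_getElem (S : NumerationSystem A) {M : DFA A σ} (hM : M.accepts = S.lang)
    {m n : ℕ} (hn : n < (words (paddedDFA M) (padLetters A) m (some none)).length) :
    (S.rep n).length ≤ m ∧
      (words (paddedDFA M) (padLetters A) m (some none))[n] = padTo m (S.rep n) := by
  set l := words (paddedDFA M) (padLetters A) m (some none) with hldef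
  have hl : ∀ u, u ∈ l ↔ ∃ w ∈ S.lang, w.length ≤ m ∧ u = padTo m w := by
    intro u
    rw [hldef, mem_words mem_padLetters, paddedDFA_eval_mem_accept, hM]
    constructor
    · rintro ⟨rfl, h⟩
      exact h
    · rintro ⟨w, hw, h, rfl⟩
      refine ⟨length_padTo h, w, hw, ?_⟩
      rw [length_padTo h]
      exact ⟨h, rfl⟩
  have hpw : l.Pairwise (List.Lex padLt) := (pairwise_allWords pairwise_padLetters m).filter _
  have hrep := rep_eq_getElem S (l := l.map List.reduceOption) (n := n)
    (by
      rw [List.pairwise_map]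
      refine hpw.imp_of_mem fun {u v} hu hv h => ?_
      obtain ⟨u, -, hu', rfl⟩ := (hl _).1 hu
      obtain ⟨v, -, hv', rfl⟩ := (hl _).1 hv
      rw [reduceOption_padTo, reduceOption_padTo]
      exact genealogical_of_lex_padTo hu' hv' h)
    (by
      intro w hw
      obtain ⟨u, hu, rfl⟩ := List.mem_map.1 hw
      obtain ⟨w, hw, -, rfl⟩ := (hl _).1 hu
      rwa [reduceOption_padTo])
    (by
      intro w hw v hv hvw
      obtain ⟨u, hu, rfl⟩ := List.mem_map.1 hw
      obtain ⟨w, -, hw, rfl⟩ := (hl _).1 hu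
      rw [reduceOption_padTo, Genealogical, List.shortlex_def] at hvw
      exact List.mem_map.2 ⟨padTo m v, (hl _).2 ⟨v, hv, by omega, rfl⟩, reduceOption_padTo m v⟩)
    (by rwa [List.length_map])
  obtain ⟨w, -, hw, e⟩ := (hl _).1 (List.getElem_mem hn)
  rw [List.getElem_map, e, reduceOption_padTo] at hrep
  rw [hrep]
  exact ⟨hw, e⟩

/-- Passing to longer padded words only prepends padding to the items already present. -/
theorem items_paddedDFA_prefix (M : DFA A σ) (i m r : ℕ) :
    (items (paddedDFA M) (padLetters A) i m (some none)).map
      (fun z => (List.replicate r none ++ z.1, z.2)) <+: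
        items (paddedDFA M) (padLetters A) i (r + m) (some none) := by
  induction r with
  | zero => simp
  | succ r ih =>
    rw [show r + 1 + m = 1 + (r + m) by omega, items_add]
    simp only [allWords, padLetters, List.map_cons, List.map_nil, List.flatMap_cons,
      List.singleton_append, List.replicate_succ]
    refine List.IsPrefix.trans ?_ (List.prefix_append _ _)
    have := ih.map (fun z => (none :: z.1, z.2))
    rw [List.map_map] at this
    exact this

theorem length_words_paddedDFA_mono (M : DFA A σ) :
    Monotone fun m => (words (paddedDFA M) (padLetters A) m (some none)).length := by
  refine monotone_nat_of_le_succ fun m => ?_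
  have := (items_paddedDFA_prefix M 0 m 1).length_le
  rw [List.length_map, length_items, length_items, add_comm 1 m] at this
  exact this

theorem tendsto_length_words_paddedDFA (S : NumerationSystem A) {M : DFA A σ}
    (hM : M.accepts = S.lang) :
    Filter.Tendsto (fun m => (words (paddedDFA M) (padLetters A) m (some none)).length)
      Filter.atTop Filter.atTop := by
  classical
  refine Filter.tendsto_atTop_atTop_of_monotone (length_words_paddedDFA_mono M) fun n => ?_
  obtain ⟨T, hT, hc⟩ := S.infinite.exists_subset_card_eq n
  have hle : ∀ w ∈ T, w.length ≤ T.sup List.length := fun w hw => Finset.le_sup hw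
  -- the padded words of the elements of `T` are `n` accepted words of the same length
  refine ⟨T.sup List.length, ?_⟩
  rw [← hc, ← Finset.card_image_of_injOn (f := padTo (T.sup List.length))
    (fun u _ v _ e => by
      rw [← reduceOption_padTo (T.sup List.length) u, e, reduceOption_padTo])]
  refine (Finset.card_le_card fun u hu => ?_).trans (List.toFinset_card_le _)
  obtain ⟨w, hw, rfl⟩ := Finset.mem_image.1 hu
  rw [List.mem_toFinset, mem_words mem_padLetters, paddedDFA_eval_mem_accept, hM,
    length_padTo (hle w hw)]
  exact ⟨rfl, w, hT hw, hle w hw, rfl⟩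

/-- Two lengths `i < i + p` at which the numbers of accepted words compare well from every state:
none of the numbers decreases, none becomes positive, and the number from the initial state
increases strictly. This is an instance of Dickson's lemma. -/
theorem exists_comparable_lengths [Finite σ] (S : NumerationSystem A) {M : DFA A σ}
    (hM : M.accepts = S.lang) : ∃ i p,
      (∀ q, (words (paddedDFA M) (padLetters A) i q).length ≤
        (words (paddedDFA M) (padLetters A) (p + i) q).length) ∧
      (∀ q, (words (paddedDFA M) (padLetters A) i q).length = 0 →
        (words (paddedDFA M) (padLetters A) (p + i) q).length = 0) ∧
      0 < (words (paddedDFA M) (padLetters A) i (some none)).length ∧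
      (words (paddedDFA M) (padLetters A) i (some none)).length <
        (words (paddedDFA M) (padLetters A) (p + i) (some none)).length := by
  obtain ⟨φ, hφ, hN⟩ := Filter.strictMono_subseq_of_tendsto_atTop
    (tendsto_length_words_paddedDFA S hM)
  -- the vector of the numbers together with the indicator vector of its zeros
  let f : ℕ → Option (Option σ) ⊕ Option (Option σ) → ℕ := fun k =>
    Sum.elim (fun q => (words (paddedDFA M) (padLetters A) (φ (k + 1)) q).length)
      fun q => if (words (paddedDFA M) (padLetters A) (φ (k + 1)) q).length = 0 then 1 else 0
  obtain ⟨k, l, hkl, hle⟩ := wellQuasiOrdered_le f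
  have hφkl : φ (k + 1) < φ (l + 1) := hφ (by omega)
  refine ⟨φ (k + 1), φ (l + 1) - φ (k + 1), fun q => ?_, fun q h => ?_, ?_, ?_⟩
  · rw [Nat.sub_add_cancel hφkl.le]
    exact hle (Sum.inl q)
  · rw [Nat.sub_add_cancel hφkl.le]
    have := hle (Sum.inr q)
    simp only [f, Sum.elim_inr, h, if_true] at this
    by_contra hne
    rw [if_neg hne] at this
    omega
  · exact (Nat.zero_le _).trans_lt (hN (show 0 < k + 1 by omega))
  · rw [Nat.sub_add_cancel hφkl.le]
    exact hN (show k + 1 < l + 1 by omega)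

end Padded

/-! ### Distribution of a list over nonempty blocks -/

/-- A list can be cut into `n` consecutive nonempty blocks if it has at least `n` elements and
is empty if `n = 0`: the first block takes the surplus, and the others are singletons. -/
theorem eq_flatMap_take_drop {α : Type} {l : List α} {n : ℕ} (hn : n ≤ l.length)
    (h0 : n = 0 → l.length = 0) :
    l = (List.range n).flatMap fun t =>
      (l.drop (if t = 0 then 0 else l.length - n + t)).take
        (if t = 0 then l.length - n + 1 else 1) := by
  obtain rfl | hpos := Nat.eq_zero_or_pos n
  · simpa using h0 rfl
  suffices h : ∀ t, t < n → (List.range (t + 1)).flatMap (fun t =>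
      (l.drop (if t = 0 then 0 else l.length - n + t)).take
        (if t = 0 then l.length - n + 1 else 1)) = l.take (l.length - n + (t + 1)) by
    have := h (n - 1) (by omega)
    rw [Nat.sub_add_cancel hpos, Nat.sub_add_cancel hn, List.take_length] at this
    exact this.symm
  intro t ht
  induction t with
  | zero => simp
  | succ t ih =>
    rw [List.range_succ, List.flatMap_append, ih (by omega), ← add_assoc (l.length - n) (t + 1) 1,
      List.take_add (i := l.length - n + (t + 1)) (j := 1)]
    simp

/-- The child of rank `j` of the `n`th element of a list is found at index `cum w n + j`. -/
theorem getElem?_flatMap {α β : Type} {g : α → List β} {l : List α} {w : ℕ → ℕ}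
    (hw : ∀ k a, l[k]? = some a → (g a).length = w k) {n j : ℕ} {a : α} {b : β}
    (hn : l[n]? = some a) (hj : (g a)[j]? = some b) :
    (l.flatMap g)[cum w n + j]? = some b := by
  induction l generalizing n w with
  | nil => simp at hn
  | cons c l ih =>
    have hc := hw 0 c rfl
    rw [List.flatMap_cons]
    obtain _ | n := n
    · obtain rfl : c = a := by simpa using hn
      rw [cum_zero, zero_add, List.getElem?_append_left (List.getElem?_eq_some_iff.1 hj).1, hj]
    · have e : cum w (n + 1) = cum (fun k => w (k + 1)) n + w 0 := by
        simp [cum, Finset.sum_range_succ']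
      rw [e, List.getElem?_append_right (by omega), hc,
        show cum (fun k => w (k + 1)) n + w 0 + j - w 0 = cum (fun k => w (k + 1)) n + j by omega]
      exact ih (fun k a h => hw (k + 1) a h) hn

theorem length_le_length_flatMap {α β : Type} {g : α → List β} {l : List α}
    (h : ∀ a ∈ l, 1 ≤ (g a).length) : l.length ≤ (l.flatMap g).length := by
  induction l with
  | nil => simp
  | cons a l ih =>
    rw [List.flatMap_cons, List.length_append, List.length_cons]
    have := h a (by simp)
    have := ih fun b hb => h b (by simp [hb])
    omega

/-! ### The one-dimensional rule on items -/

section Items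

variable {X Q : Type}

/-- The number of children of an item `(u, t)` with `D` in the state `q` after `u`: when words are
prolonged by `p` letters, the items after `u` are distributed over the items `(u, t)`, the first
one taking all the surplus. -/
noncomputable def itemWidth (D : DFA X Q) (s : List X) (i p : ℕ) (q : Q) (t : ℕ) : ℕ :=
  if t = 0 then (words D s (p + i) q).length - (words D s i q).length + 1 else 1

/-- The child of rank `j` of an item `(u, t)` with `D` in the state `q` after `u`; its first
component is to be appended to `u`. -/
noncomputable def itemChild (D : DFA X Q) (s : List X) (i p : ℕ) (q : Q) (t j : ℕ) : List X × ℕ :=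
  (items D s i p q).getD
    ((if t = 0 then 0 else (words D s (p + i) q).length - (words D s i q).length + t) + j) ([], 0)

theorem one_le_itemWidth (D : DFA X Q) (s : List X) (i p : ℕ) (q : Q) (t : ℕ) :
    1 ≤ itemWidth D s i p q t := by
  rw [itemWidth]
  split <;> omega

/-- The items at length `M + p` arise from those at length `M` by replacing every item by its
children. The numbers of accepted words must satisfy the inequalities that let every item have a
child and leave no item without a parent. -/
theorem exists_items_add_eq_flatMap {D : DFA X Q} {s : List X} (hs : ∀ a, a ∈ s) {i p : ℕ}
    (hle : ∀ q, (words D s i q).length ≤ (words D s (p + i) q).length)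
    (hz : ∀ q, (words D s i q).length = 0 → (words D s (p + i) q).length = 0) (M : ℕ) (q : Q) :
    ∃ g : List X × ℕ → List (List X × ℕ),
      items D s i (M + p) q = (items D s i M q).flatMap g ∧
      ∀ z ∈ items D s i M q,
        (g z).length = itemWidth D s i p (D.evalFrom q z.1) z.2 ∧
        ∀ j < itemWidth D s i p (D.evalFrom q z.1) z.2,
          (g z)[j]? = some (z.1 ++ (itemChild D s i p (D.evalFrom q z.1) z.2 j).1,
            (itemChild D s i p (D.evalFrom q z.1) z.2 j).2) := by
  let g : List X × ℕ → List (List X × ℕ) := fun z =>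
    (((items D s i p (D.evalFrom q z.1)).drop
      (if z.2 = 0 then 0 else (words D s (p + i) (D.evalFrom q z.1)).length -
        (words D s i (D.evalFrom q z.1)).length + z.2)).take
      (itemWidth D s i p (D.evalFrom q z.1) z.2)).map fun c => (z.1 ++ c.1, c.2)
  refine ⟨g, ?_, fun z hz' => ?_⟩
  · rw [items_add, items, List.flatMap_assoc]
    congr 1
    funext u
    rw [List.flatMap_map]
    have := eq_flatMap_take_drop (l := items D s i p (D.evalFrom q u))
      (n := (words D s i (D.evalFrom q u)).length)
      (by rw [length_items]; exact hle (D.evalFrom q u))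
      (by rw [length_items]; exact hz (D.evalFrom q u))
    conv_lhs => rw [this, List.map_flatMap]
    simp only [g, length_items, itemWidth]
  · have ht := ((mem_items hs).1 hz').2
    have hl := hle (D.evalFrom q z.1)
    set q' := D.evalFrom q z.1 with hq'
    have hlen : (if z.2 = 0 then 0 else (words D s (p + i) q').length - (words D s i q').length
        + z.2) + itemWidth D s i p q' z.2 ≤ (items D s i p q').length := by
      rw [length_items, itemWidth]
      split <;> omega
    refine ⟨?_, fun j hj => ?_⟩
    · simp only [g, ← hq', List.length_map, List.length_take, List.length_drop]
      omega
    · rw [itemChild, List.getD_eq_getElem _ _ (by omega)]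
      simp only [g, ← hq', List.getElem?_map, List.getElem?_take, if_pos hj, List.getElem?_drop]
      rw [List.getElem?_eq_getElem (by omega)]
      rfl

end Items

/-! ### Automatic words are shape-symmetric up to a coding -/

theorem cols_replicate {d : ℕ} {X : Type} (e : X) (r : ℕ) :
    cols e r (fun _ : Fin d => List.replicate r e) = List.replicate r fun _ => e := by
  refine List.ext_getElem (by simp [cols]) fun t h₁ h₂ => ?_
  simp [cols]

theorem foldl_replicate_of_fixed {E Y : Type} {st : E → Y → E} {y : Y} (h : ∀ e, st e y = e)
    (e : E) (r : ℕ) : (List.replicate r y).foldl st e = e := by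
  induction r with
  | zero => rfl
  | succ r ih => rw [List.replicate_succ, List.foldl_cons, h, ih]

theorem eq_of_const_succ {α : Type} {f : ℕ → α} {V : ℕ → Prop} (hV : ∀ k, V k → V (k + 1))
    (hf : ∀ k, V k → f (k + 1) = f k) {k l : ℕ} (hk : V k) (hl : V l) : f k = f l := by
  have h : ∀ k r, V k → V (k + r) ∧ f (k + r) = f k := by
    intro k r hk
    induction r with
    | zero => exact ⟨hk, rfl⟩
    | succ r ih => exact ⟨hV _ ih.1, (hf _ ih.1).trans ih.2⟩
  rcases le_total k l with hkl | hkl <;> obtain ⟨r, rfl⟩ := Nat.exists_eq_add_of_le hkl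
  · exact (h k r hk).2.symm
  · exact (h l r hl).2

section Automatic

variable {A σ : Type} [LinearOrder A] [Finite A]

/-- The items at level `k`, which describe the padded accepted words of length `p * k + i`. -/
noncomputable def levelItems (M : DFA A σ) (i p k : ℕ) : List (List (Option A) × ℕ) :=
  items (paddedDFA M) (padLetters A) i (p * k) (some none)

theorem levelItems_succ_getElem? {M : DFA A σ} {i p k n : ℕ} {z : List (Option A) × ℕ}
    (h : (levelItems M i p k)[n]? = some z) :
    (levelItems M i p (k + 1))[n]? = some (List.replicate p none ++ z.1, z.2) := by
  obtain ⟨t, ht⟩ := items_paddedDFA_prefix M i (p * k) p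
  rw [levelItems, show p * (k + 1) = p + p * k by ring, ← ht, List.getElem?_append_left,
    List.getElem?_map]
  · change ((levelItems M i p k)[n]?).map _ = _
    rw [h]; rfl
  · rw [List.length_map]
    exact (List.getElem?_eq_some_iff.1 h).1

/-- The first item consists of padding only, and as it has at least two children the number of
items grows with the level. -/
theorem lt_length_levelItems {M : DFA A σ} {i p : ℕ}
    (hle : ∀ q, (words (paddedDFA M) (padLetters A) i q).length ≤
      (words (paddedDFA M) (padLetters A) (p + i) q).length)
    (hz : ∀ q, (words (paddedDFA M) (padLetters A) i q).length = 0 →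
      (words (paddedDFA M) (padLetters A) (p + i) q).length = 0)
    (hpos : 0 < (words (paddedDFA M) (padLetters A) i (some none)).length)
    (hlt : (words (paddedDFA M) (padLetters A) i (some none)).length <
      (words (paddedDFA M) (padLetters A) (p + i) (some none)).length) (k : ℕ) :
    (levelItems M i p k)[0]? = some (List.replicate (p * k) none, 0) ∧
      k < (levelItems M i p k).length := by
  have hhead : ∀ k, (levelItems M i p k)[0]? = some (List.replicate (p * k) none, 0) := by
    intro k
    induction k with
    | zero =>
      rw [levelItems, mul_zero]
      simp only [items, allWords, List.flatMap_singleton, List.replicate_zero]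
      change ((List.range (words (paddedDFA M) (padLetters A) i (some none)).length).map _)[0]? = _
      rw [List.getElem?_map, List.getElem?_range hpos]
      rfl
    | succ k ih =>
      rw [levelItems_succ_getElem? ih, ← List.replicate_add]
      congr 3
      ring
  refine ⟨hhead k, ?_⟩
  induction k with
  | zero => exact (List.getElem?_eq_some_iff.1 (hhead 0)).1
  | succ k ih =>
    obtain ⟨g, hg, hgz⟩ := exists_items_add_eq_flatMap mem_padLetters hle hz (p * k) (some none)
    have hh := hhead k
    have hmem : ∀ z ∈ levelItems M i p k, 1 ≤ (g z).length := fun z hz => by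
      rw [(hgz z hz).1]; exact one_le_itemWidth _ _ _ _ _ _
    have hlen : (levelItems M i p (k + 1)).length =
        ((levelItems M i p k).flatMap g).length := congrArg List.length hg
    rw [hlen]
    have h0 : 2 ≤ (g (List.replicate (p * k) none, 0)).length := by
      rw [(hgz _ (List.mem_of_getElem? hh)).1]
      have := paddedDFA_evalFrom_replicate_none M (p * k) []
      rw [List.append_nil] at this
      rw [this, DFA.evalFrom_nil, itemWidth, if_pos rfl]
      omega
    generalize levelItems M i p k = l at *
    obtain _ | ⟨a, l⟩ := l
    · simp at hh
    · obtain rfl : a = _ := by simpa using hh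
      have := length_le_length_flatMap (g := g) (l := l) fun b hb => hmem b (by simp [hb])
      rw [List.flatMap_cons, List.length_append]
      rw [List.length_cons] at ih
      omega

/-- The label of `n` at level `k`: the state after the first component of the `n`th item, and the
second component. -/
noncomputable def levelLabel (M : DFA A σ) (i p K k n : ℕ) : Option (Option σ) × Fin (K + 1) :=
  let z := (levelItems M i p k).getD n ([], 0)
  ((paddedDFA M).evalFrom (some none) z.1, Fin.ofNat (K + 1) z.2)

variable {d : ℕ} {E : Type}

/-- The label of the position `n` of a multidimensional word at level `k`: the labels of its
coordinates, and the state that a synchronous automaton with transition function `st` reaches from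
`e₀` on the first components of the items. -/
noncomputable def levelLetter (M : DFA A σ) (i p K : ℕ) (st : E → (Fin d → Option A) → E) (e₀ : E)
    (k : ℕ) (n : Fin d → ℕ) : (Fin d → Option (Option σ) × Fin (K + 1)) × E :=
  (fun c => levelLabel M i p K k (n c),
    (cols none (p * k) fun c => ((levelItems M i p k).getD (n c) ([], 0)).1).foldl st e₀)

/-- Reading the representations of the coordinates by a synchronous automaton on which padding has
no effect yields the coding of a shape-symmetric word, whose letters are the level-independent
labels of the positions. -/
theorem exists_isShapeSymmetric [Finite σ] [Finite E] (S : NumerationSystem A) {M : DFA A σ}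
    (hM : M.accepts = S.lang) (st : E → (Fin d → Option A) → E) (e₀ : E)
    (hst : ∀ e, st e (fun _ => none) = e) :
    ∃ (B : Type) (_ : Finite B) (y : (Fin d → ℕ) → B) (ν : B → E), IsShapeSymmetric y ∧
      ∀ n, ∃ m, (∀ c, (S.rep (n c)).length ≤ m) ∧
        ν (y n) = (cols none m fun c => padTo m (S.rep (n c))).foldl st e₀ := by
  obtain ⟨i, p, hle, hz, hpos, hlt⟩ := exists_comparable_lengths S hM
  have hL := lt_length_levelItems hle hz hpos hlt
  obtain ⟨K, hK⟩ := (Set.finite_range fun q =>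
    (words (paddedDFA M) (padLetters A) i q).length).bddAbove
  replace hK : ∀ q, (words (paddedDFA M) (padLetters A) i q).length ≤ K := fun q => hK ⟨q, rfl⟩
  set D := paddedDFA M
  set s := padLetters A
  have hget : ∀ {k n : ℕ}, n < (levelItems M i p k).length →
      ∃ z, (levelItems M i p k)[n]? = some z ∧ (levelItems M i p k).getD n ([], 0) = z ∧
        z.1.length = p * k ∧ z.2 < (words D s i (D.evalFrom (some none) z.1)).length ∧
        levelLabel M i p K k n = (D.evalFrom (some none) z.1, Fin.ofNat (K + 1) z.2) ∧
        ((Fin.ofNat (K + 1) z.2 : Fin (K + 1)) : ℕ) = z.2 := by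
    intro k n hn
    have hm := (mem_items mem_padLetters).1
      (List.getElem_mem hn : (levelItems M i p k)[n] ∈ items _ _ _ _ _)
    refine ⟨(levelItems M i p k)[n], List.getElem?_eq_getElem hn, List.getD_eq_getElem _ _ hn,
      hm.1, hm.2, ?_, ?_⟩
    · rw [levelLabel, List.getD_eq_getElem _ _ hn]
    · rw [Fin.val_ofNat, Nat.mod_eq_of_lt]
      exact Nat.lt_succ_of_le (hm.2.le.trans (hK _))
  have hV : ∀ n k, n < (levelItems M i p k).length → n < (levelItems M i p (k + 1)).length := by
    intro n k hn
    obtain ⟨z, hzz, -⟩ := hget hn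
    exact (List.getElem?_eq_some_iff.1 (levelItems_succ_getElem? hzz)).1
  -- as reading padding has no effect, labels do not depend on the level
  have hlabel : ∀ n k l, n < (levelItems M i p k).length → n < (levelItems M i p l).length →
      levelLabel M i p K k n = levelLabel M i p K l n := by
    intro n k l hk hl
    refine eq_of_const_succ (f := fun k => levelLabel M i p K k n) (hV n) (fun k hk => ?_) hk hl
    obtain ⟨z, hzz, hzD, -⟩ := hget hk
    have hz' : (levelItems M i p (k + 1)).getD n ([], 0) =
        (List.replicate p none ++ z.1, z.2) := by
      rw [List.getD_eq_getElem?_getD, levelItems_succ_getElem? hzz]; rfl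
    simp only [levelLabel, hzD, hz', paddedDFA_evalFrom_replicate_none]
  have hletter : ∀ (n : Fin d → ℕ) k l, (∀ c, n c < (levelItems M i p k).length) →
      (∀ c, n c < (levelItems M i p l).length) →
      levelLetter M i p K st e₀ k n = levelLetter M i p K st e₀ l n := by
    intro n k l hk hl
    refine eq_of_const_succ (f := fun k => levelLetter M i p K st e₀ k n)
      (V := fun k => ∀ c, n c < (levelItems M i p k).length)
      (fun k hk c => hV _ k (hk c)) (fun k hk => ?_) hk hl
    choose z hzz hzD hz1 hz2 hzl hzv using fun c => hget (hk c)
    have hz' : ∀ c, (levelItems M i p (k + 1)).getD (n c) ([], 0) =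
        (List.replicate p none ++ (z c).1, (z c).2) := fun c => by
      rw [List.getD_eq_getElem?_getD, levelItems_succ_getElem? (hzz c)]; rfl
    refine Prod.ext (funext fun c => hlabel _ _ _ (hV _ _ (hk c)) (hk c)) ?_
    simp only [levelLetter, hz', hzD]
    rw [show p * (k + 1) = p + p * k by ring, cols_append none p (p * k)
      (fun _ => List.replicate p none) (fun c => (z c).1) fun _ => List.length_replicate,
      cols_replicate, List.foldl_append, foldl_replicate_of_fixed hst]
  let W : Option (Option σ) × Fin (K + 1) → ℕ := fun c => itemWidth D s i p c.1 c.2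
  let ω : ℕ → ℕ := fun n => W (levelLabel M i p K n n)
  let F : Option (Option σ) × Fin (K + 1) → ℕ → Option (Option σ) × Fin (K + 1) := fun c j =>
    (D.evalFrom c.1 (itemChild D s i p c.1 c.2 j).1,
      Fin.ofNat (K + 1) (itemChild D s i p c.1 c.2 j).2)
  let G : (Fin d → Option (Option σ) × Fin (K + 1)) × E → (Fin d → ℕ) → E := fun b j =>
    (cols none p fun c => (itemChild D s i p (b.1 c).1 (b.1 c).2 (j c)).1).foldl st b.2
  have hW : ∀ c, 1 ≤ W c := fun c => one_le_itemWidth _ _ _ _ _ _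
  let y : (Fin d → ℕ) → (Fin d → Option (Option σ) × Fin (K + 1)) × E :=
    fun n => levelLetter M i p K st e₀ (∑ c, n c) n
  have hvalid : ∀ n : Fin d → ℕ, ∀ c, n c < (levelItems M i p (∑ c, n c)).length := fun n c =>
    (Finset.single_le_sum (fun _ _ => Nat.zero_le _) (Finset.mem_univ c)).trans_lt (hL _).2
  have hwidth : HasWidth (productMap W hW F G) y ω := by
    refine ⟨fun n c => ?_, fun n j => ?_⟩
    · change W (levelLabel M i p K (∑ c, n c) (n c)) = _
      rw [hlabel _ _ (n c) (hvalid n c) (hL _).2]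
    · set k := ∑ c, n c with hk
      have hvk : ∀ c, n c < (levelItems M i p k).length := hvalid n
      choose z hzz hzD hz1 hz2 hzl hzv using fun c => hget (hvk c)
      obtain ⟨g, hg, hgz⟩ := exists_items_add_eq_flatMap mem_padLetters hle hz (p * k) (some none)
      have hgw : ∀ t a, (levelItems M i p k)[t]? = some a → (g a).length = ω t := by
        intro t a hta
        have ht := (List.getElem?_eq_some_iff.1 hta).1
        obtain ⟨a', ha', -, -, -, hal, hav⟩ := hget ht
        obtain rfl : a = a' := by simpa [hta] using ha'
        rw [(hgz a (List.mem_of_getElem? hta)).1]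
        simp only [ω]
        rw [hlabel t t k (hL _).2 ht, hal]
        simp only [W, hav]
        rfl
      have hjw : ∀ c, (j c : ℕ) < itemWidth D s i p (D.evalFrom (some none) (z c).1) (z c).2 := by
        intro c
        have : (j c : ℕ) < W (levelLabel M i p K k (n c)) := (j c).2
        rw [hzl] at this
        simpa only [W, hzv] using this
      have hchild : ∀ c, (levelItems M i p (k + 1))[cum ω (n c) + j c]? = some
          ((z c).1 ++ (itemChild D s i p (D.evalFrom (some none) (z c).1) (z c).2 (j c)).1,
            (itemChild D s i p (D.evalFrom (some none) (z c).1) (z c).2 (j c)).2) := by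
        intro c
        have := getElem?_flatMap hgw (hzz c)
          ((hgz _ (List.mem_of_getElem? (hzz c))).2 (j c) (hjw c))
        rw [← this]
        exact congrArg (fun l => l[_]?) hg
      have hchildD : ∀ c, (levelItems M i p (k + 1)).getD (cum ω (n c) + j c) ([], 0) =
          ((z c).1 ++ (itemChild D s i p (D.evalFrom (some none) (z c).1) (z c).2 (j c)).1,
            (itemChild D s i p (D.evalFrom (some none) (z c).1) (z c).2 (j c)).2) := fun c => by
        rw [List.getD_eq_getElem?_getD, hchild c]; rfl
      have e : y (fun c => cum ω (n c) + j c) =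
          levelLetter M i p K st e₀ (k + 1) fun c => cum ω (n c) + j c :=
        hletter _ _ _ (hvalid _) fun c => (List.getElem?_eq_some_iff.1 (hchild c)).1
      rw [e]
      have hyn : y n = (fun c => (D.evalFrom (some none) (z c).1, Fin.ofNat (K + 1) (z c).2),
          (cols none (p * k) fun c => (z c).1).foldl st e₀) := by
        simp only [y, levelLetter, hzl, hzD, ← hk]
      refine Prod.ext ?_ ?_
      · funext c
        change levelLabel M i p K (k + 1) (cum ω (n c) + j c) = F ((y n).1 c) (j c)
        simp only [levelLabel, hchildD, hyn, F, hzv, DFA.evalFrom_of_append]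
        rfl
      · change _ = G (y n) fun c => j c
        simp only [levelLetter, hchildD, hyn, G, hzv]
        rw [show p * (k + 1) = p * k + p by ring, cols_append none (p * k) p (fun c => (z c).1)
          _ hz1, List.foldl_append]
  have hω0 : 2 ≤ ω 0 := by
    obtain ⟨z, hzz, -, -, -, hzl, hzv⟩ := hget (hL 0).2
    rw [(hL 0).1] at hzz
    obtain rfl := Option.some.inj hzz
    have : ω 0 = W (levelLabel M i p K 0 0) := rfl
    rw [this, hzl]
    simp only [W, hzv, itemWidth, mul_zero, List.replicate_zero, DFA.evalFrom_nil, if_true]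
    omega
  refine ⟨_, inferInstance, y, fun b => (cols none i fun c =>
      (words D s i (b.1 c).1).getD (b.1 c).2 []).foldl st b.2,
    isShapeSymmetric_of_hasWidth (isMorphism_productMap W hW F G) hwidth (fun n => hW _) hω0,
    fun n => ?_⟩
  set k := ∑ c, n c with hk
  have hvk : ∀ c, n c < (levelItems M i p k).length := hvalid n
  choose z hzz hzD hz1 hz2 hzl hzv using fun c => hget (hvk c)
  have hlen : ∀ c, n c < (words D s (p * k + i) (some none)).length := fun c => by
    rw [← length_items]; exact hvalid n c
  have hrep := fun c => words_paddedDFA_getElem S hM (hlen c)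
  refine ⟨p * k + i, fun c => (hrep c).1, ?_⟩
  have hpad : ∀ c, padTo (p * k + i) (S.rep (n c)) =
      (z c).1 ++ (words D s i (D.evalFrom (some none) (z c).1)).getD (z c).2 [] := by
    intro c
    rw [← (hrep c).2]
    have := congrArg (fun l => l[n c]?) (words_add_eq_map_items D s i (p * k) (some none))
    simp only [List.getElem?_map] at this
    rw [show (items D s i (p * k) (some none))[n c]? = some (z c) from hzz c] at this
    exact (List.getElem?_eq_some_iff.1 this).2
  simp only [y, levelLetter, hzl, hzD, hzv, hpad, ← hk]
  rw [cols_append none (p * k) i (fun c => (z c).1) _ hz1, List.foldl_append]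

end Automatic

theorem exists_isShapeSymmetric_of_isAutomaticFor {d : ℕ} {Γ : Type*} {A : Type} [LinearOrder A]
    [Finite A] (S : NumerationSystem A) {x : (Fin d → ℕ) → Γ} (hx : IsAutomaticFor S x) :
    ∃ (B : Type) (_ : Finite B) (y : (Fin d → ℕ) → B) (ν : B → Γ),
      IsShapeSymmetric y ∧ x = fun n => ν (y n) := by
  classical
  obtain ⟨E, _, N, hN⟩ := hx
  obtain ⟨σ, _, M, hM⟩ := S.isRegular
  -- a column of padding letters never occurs in a padded tuple, so it may be read without effect
  let st : E → (Fin d → Option A) → E := fun e c => if c = fun _ => none then e else N.step e c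
  have hst : ∀ e, st e (fun _ => none) = e := fun e => if_pos rfl
  obtain ⟨B, hB, y, ν, hy, h⟩ := exists_isShapeSymmetric S hM st N.start hst
  refine ⟨B, hB, y, fun b => N.out (ν b), hy, ?_⟩
  funext n
  obtain ⟨m, hm, e⟩ := h n
  simp only [e]
  rw [← hN n, DFAO.output, padTuple_eq_cols]
  set l := Finset.univ.sup fun c => (S.rep (n c)).length with hl
  have hle : ∀ c, (S.rep (n c)).length ≤ l := fun c =>
    Finset.le_sup (f := fun c => (S.rep (n c)).length) (Finset.mem_univ c)
  obtain ⟨r, rfl⟩ : ∃ r, m = r + l :=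
    ⟨m - l, by have : l ≤ m := Finset.sup_le fun c _ => hm c
               omega⟩
  have hpad : ∀ c, padTo (r + l) (S.rep (n c)) =
      List.replicate r none ++ padTo l (S.rep (n c)) := fun c => by
    rw [padTo, padTo, ← List.append_assoc, ← List.replicate_add, Nat.add_sub_assoc (hle c)]
  simp only [hpad]
  rw [cols_append none r l (fun _ => List.replicate r none) (fun c => padTo l (S.rep (n c)))
    fun _ => List.length_replicate, cols_replicate, List.foldl_append,
    foldl_replicate_of_fixed hst]
  congr 1
  refine List.foldl_ext _ _ _ fun e c hc => (if_neg ?_).symm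
  rintro rfl
  -- a longest representation is not padded
  obtain ⟨t, ht, htc⟩ := List.mem_map.1 hc
  rw [List.mem_range] at ht
  obtain ⟨c, -, hc⟩ : ∃ c ∈ Finset.univ, t < (S.rep (n c)).length := Finset.lt_sup_iff.1 ht
  obtain ⟨c', -, hc'⟩ := Finset.exists_mem_eq_sup Finset.univ ⟨c, Finset.mem_univ c⟩
    fun c => (S.rep (n c)).length
  have := congrFun htc c'
  rw [← hl] at hc'
  simp only [padTo, hc', Nat.sub_self, List.replicate_zero, List.nil_append] at this
  rw [List.getD_eq_getElem _ _ (by simpa [← hc'] using ht)] at this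
  simp at this

end MultiWord

theorem mainTheorem1 (d : ℕ) (hd : 1 ≤ d) {Γ : Type*} [Finite Γ] (x : (Fin d → ℕ) → Γ) :
    (∃ (A : Type) (_ : LinearOrder A) (_ : Finite A) (S : MultiWord.NumerationSystem A),
      [] ∈ S.lang ∧ MultiWord.IsAutomaticFor S x) ↔
    (∃ (B : Type) (_ : Finite B) (y : (Fin d → ℕ) → B) (ν : B → Γ),
      MultiWord.IsShapeSymmetric y ∧ x = fun n => ν (y n)) := by
  constructor
  · rintro ⟨A, _, _, S, -, hx⟩
    exact MultiWord.exists_isShapeSymmetric_of_isAutomaticFor S hx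
  · rintro ⟨B, _, y, ν, hy, rfl⟩
    exact MultiWord.isAutomaticFor_of_isShapeSymmetric hd ν hy
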